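/- Let $A=(A_1,\dots,A_n)$ be a tuple of complex $N\times N$ matrices. For a tuple $B=(B_1,\dots,B_p)$ of matrices (or of operators on a finite-dimensional space) the projective joint spectrum is $$\sigma(B)=\{[x_1:\dots:x_{p+1}]\in\mathbb{CP}^p:\ x_1B_1+\dots+x_pB_p-x_{p+1}I\ \text{is not invertible}\}.$$ Let $$\det(x_1A_1+\dots+x_nA_n-x_{n+1}I)=R_1(x)^{m_1}\cdots R_k(x)^{m_k}$$ be the factorization into powers ($m_s\ge 1$) of pairwise non-proportional irreducible homogeneous polynomials, and put $l_s=\deg R_s$, $\Gamma_s=\{R_s=0\}\subset\mathbb{CP}^n$. Assume that $A$ is admissible: for each $1\le j\le n$, at every point of $\sigma(A)$ of the form $[0:\dots:t:\dots:0:1]$ ($t$ in position $j$) we have $\partial_{x_j}\prod_sR_s\neq0$; and, if $A_j$ is singular, $\partial_{x_{n+1}}\prod_sR_s\ne0$ at $[0:\dots:1:\dots:0:0]$ ($1$ in position $j$). Let $1/t_{j,s,1},\dots,1/t_{j,s,l_s}$ be the (distinct) roots $z$ of $R_s(0,\dots,1,\dots,0,z)$, with $1$ in position $j$; that is, $[0:\dots:t_{j,s,r}:\dots:0:1]$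 are the points of $\Gamma_s$ on the $j$-th coordinate line, with $1/t_{j,s,r}=0$ for the point at infinity $[0:\dots:1:\dots:0:0]$. Let $S\subset\{1,\dots,k\}$, let $S^c$ be its complement, and for $1\le j\le n$ put $$q_{j,S}(z)=\prod_{s\in S}\prod_{r=1}^{l_s}\Big(z-\frac1{t_{j,s,r}}\Big)^{m_s},\qquad \alpha_{j,S}=\prod_{s\in S^c}(-1)^{l_sm_s}\prod_{r=1}^{l_s}q_{j,S}\Big(\frac1{t_{j,s,r}}\Big)^{m_s},$$ $$\mathscr P_{j,S}=\frac1{\alpha_{j,S}}\prod_{s\in S^c}\prod_{r=1}^{l_s}\Big(q_{j,S}(A_j)-q_{j,S}\Big(\frac1{t_{j,s,r}}\Big)I\Big)^{m_s}.$$ Let $\mu_{1,j},\dots,\mu_{r_j,j}$ be the positive eigenvalues of $\mathscr P_{j,S}\mathscr P_{j,S}^*$ (listed with multiplicity), and let $$Q_j(z)=1-\frac{\prod_t(\mu_{t,j}-z)}{\prod_t\mu_{t,j}},\qquad \mathscr Q_{j,S}=Q_j(\mathscr P_{j,S}\mathscr P_{j,S}^*),\qquad M_S=\sum_{s\in S}l_sm_s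 .$$ Finally let $A_\Lambda=\mathrm{diag}(\lambda_1,\dots,\lambda_N)$ with distinct $\lambda_i\in\mathbb C$, and let $T$ be the shift matrix $Te_i=e_{i+1}$ ($i<N$), $Te_N=0$. Then the following are equivalent. (a) $\bigcup_{s\in S}\Gamma_s$ corresponds to a common invariant subspace: there is a subspace $M\subset\mathbb C^N$ with $A_jM\subset M$ for all $j$, $\dim M=M_S$ and $\sigma(A_1|_M,\dots,A_n|_M)=\bigcup_{s\in S}\Gamma_s$. (b) $\sigma(\mathscr Q_{1,S},\dots,\mathscr Q_{n,S})=\{(x_1+\dots+x_n-x_{n+1})^{M_S}x_{n+1}^{N-M_S}=0\}$ as subsets of $\mathbb{CP}^n$. (b$'$) The same with multiplicities: $\det(\sum_jx_j\mathscr Q_{j,S}-x_{n+1}I)=(-1)^{N-M_S}(x_1+\dots+x_n-x_{n+1})^{M_S}x_{n+1}^{N-M_S}$ as polynomials. (c) The set $\sigma(A_\Lambda,T,T^*,\mathscr Q_{1,S},\dots,\mathscr Q_{n,S})\subset\mathbb{CP}^{n+3}$ is invariant under all permutations of the variables $x_4,\dots,x_{n+3}$. -/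

import Mathlib

open scoped Matrix

noncomputable section

namespace JointSpec

/-! For a tuple indexed by a finite type `κ`, the homogeneous coordinates are indexed by
`Option κ`: the coordinate `some j` is the variable `x_j` that multiplies the `j`-th member of
the tuple, and `none` is the last variable, which multiplies `-I`. -/

/-- The pencil `A(x) = ∑ j, x_j A_j - x_∞ I` of a tuple in a complex algebra. -/
def pencil {κ : Type*} [Fintype κ] {𝒜 : Type*} [Ring 𝒜] [Algebra ℂ 𝒜]
    (A : κ → 𝒜) (x : Option κ → ℂ) : 𝒜 :=
  ∑ j, x (some j) • A j - x none • (1 : 𝒜)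

/-- The projective joint spectrum `σ(A, -I)`: the points of projective space at which the pencil
is not invertible. -/
def jointSpectrum {κ : Type*} [Fintype κ] {𝒜 : Type*} [Ring 𝒜] [Algebra ℂ 𝒜]
    (A : κ → 𝒜) : Set (Projectivization ℂ (Option κ → ℂ)) :=
  {p | ¬ IsUnit (pencil A p.rep)}

/-- The projective zero set `{F = 0}`, used for homogeneous `F` only. -/
def zeroLocus {κ : Type*} (F : MvPolynomial (Option κ) ℂ) :
    Set (Projectivization ℂ (Option κ → ℂ)) :=
  {p | MvPolynomial.eval p.rep F = 0}

/-- `det A(x)` as a polynomial in the variables `x`. -/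
def detPencil {κ : Type*} [Fintype κ] {N : ℕ} (A : κ → Matrix (Fin N) (Fin N) ℂ) :
    MvPolynomial (Option κ) ℂ :=
  Matrix.det (∑ j, (MvPolynomial.X (some j) : MvPolynomial (Option κ) ℂ) •
      (A j).map (MvPolynomial.C : ℂ →+* MvPolynomial (Option κ) ℂ)
    - (MvPolynomial.X none : MvPolynomial (Option κ) ℂ) • 1)

/-- The map of projective space that permutes the homogeneous coordinates by `e`. -/
def permuteCoords {ι : Type*} (e : Equiv.Perm ι) :
    Projectivization ℂ (ι → ℂ) → Projectivization ℂ (ι → ℂ) :=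
  Projectivization.map (LinearEquiv.funCongrLeft ℂ ℂ e).toLinearMap
    (LinearEquiv.funCongrLeft ℂ ℂ e).injective

variable {n N k : ℕ}

/-- `det A(x) = R_1(x)^{m_1} ⋯ R_k(x)^{m_k}` is the factorization of `det A(x)` into powers of
pairwise non-associated irreducible polynomials. (Homogeneity of the `R_s` is automatic.) -/
structure IsFactorization (A : Fin n → Matrix (Fin N) (Fin N) ℂ)
    (R : Fin k → MvPolynomial (Option (Fin n)) ℂ) (m : Fin k → ℕ) : Prop where
  irreducible : ∀ s, Irreducible (R s)
  pairwise_ne : ∀ s s', s ≠ s' → ¬ Associated (R s) (R s')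
  mult_pos : ∀ s, 0 < m s
  det_eq : detPencil A = ∏ s, R s ^ m s

/-- The vector `(0, …, 0, u, 0, …, 0, v)` with `u` in position `j` and `v` in the last one. -/
def linePoint (j : Fin n) (u v : ℂ) : Option (Fin n) → ℂ
  | none => v
  | some i => if i = j then u else 0

/-- The tuple is admissible: at every point `[0 : ⋯ : t : ⋯ : 0 : 1]` of the joint spectrum on the
`j`-th coordinate line the derivative of `∏ s, R_s` in `x_j` does not vanish. If `A_j` is singular,
then the joint spectrum also contains the point at infinity `[0 : ⋯ : 1 : ⋯ : 0 : 0]` of the line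
(where the derivative in `x_j` is zero by homogeneity), and the derivative in the last variable is
required not to vanish there; for invertible `A_j` this second clause is void. -/
structure Admissible (A : Fin n → Matrix (Fin N) (Fin N) ℂ)
    (R : Fin k → MvPolynomial (Option (Fin n)) ℂ) : Prop where
  regular : ∀ (j : Fin n) (t : ℂ), ¬ IsUnit (pencil A (linePoint j t 1)) →
    MvPolynomial.eval (linePoint j t 1) (MvPolynomial.pderiv (some j) (∏ s, R s)) ≠ 0
  regular_infty : ∀ j : Fin n, ¬ IsUnit (A j) →
    MvPolynomial.eval (linePoint j 1 0) (MvPolynomial.pderiv none (∏ s, R s)) ≠ 0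

/-- The numbers `1/t_{j,s,r}`, where `[0 : ⋯ : t_{j,s,r} : ⋯ : 0 : 1]` are the points of
`{R_s = 0}` on the `j`-th coordinate line (with `1/∞ = 0` for the point at infinity). As
`[0 : ⋯ : t : ⋯ : 0 : 1] = [0 : ⋯ : 1 : ⋯ : 0 : 1/t]`, these are the roots `z` of the polynomial
`R_s(0, …, 1, …, 0, z)`. -/
def lineRoots (R : Fin k → MvPolynomial (Option (Fin n)) ℂ) (j : Fin n) (s : Fin k) : Finset ℂ :=
  (MvPolynomial.aeval (fun o : Option (Fin n) => match o with
    | none => (Polynomial.X : Polynomial ℂ)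
    | some i => if i = j then 1 else 0) (R s)).roots.toFinset

/-- `q_{j,S}(z) = ∏_{s ∈ S} ∏_r (z - 1/t_{j,s,r})^{m_s}`. -/
def qPoly (R : Fin k → MvPolynomial (Option (Fin n)) ℂ) (m : Fin k → ℕ) (S : Finset (Fin k))
    (j : Fin n) : Polynomial ℂ :=
  ∏ s ∈ S, ∏ l ∈ lineRoots R j s, (Polynomial.X - Polynomial.C l) ^ m s

/-- The normalizing constant
`α_{j,S} = ∏_{s ∉ S} (-1)^{l_s m_s} ∏_r q_{j,S}(1/t_{j,s,r})^{m_s}`, with `l_s = deg R_s`. -/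
def alpha (R : Fin k → MvPolynomial (Option (Fin n)) ℂ) (m : Fin k → ℕ) (S : Finset (Fin k))
    (j : Fin n) : ℂ :=
  ∏ s ∈ Sᶜ, (-1) ^ ((R s).totalDegree * m s) *
    ∏ l ∈ lineRoots R j s, ((qPoly R m S j).eval l) ^ m s

/-- The projection
`P_{j,S} = α_{j,S}⁻¹ ∏_{s ∉ S} ∏_r (q_{j,S}(A_j) - q_{j,S}(1/t_{j,s,r}))^{m_s}`. -/
def projP (A : Fin n → Matrix (Fin N) (Fin N) ℂ) (R : Fin k → MvPolynomial (Option (Fin n)) ℂ)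
    (m : Fin k → ℕ) (S : Finset (Fin k)) (j : Fin n) : Matrix (Fin N) (Fin N) ℂ :=
  (alpha R m S j)⁻¹ • Polynomial.aeval (A j)
    (∏ s ∈ Sᶜ, ∏ l ∈ lineRoots R j s,
      (qPoly R m S j - Polynomial.C ((qPoly R m S j).eval l)) ^ m s)

/-- `Q(z) = 1 - ∏ (μ_t - z) / ∏ μ_t`, where `μ_t` runs over the positive eigenvalues of `P P*`. -/
def capPoly (P : Matrix (Fin N) (Fin N) ℂ) : Polynomial ℂ :=
  let μ := (Matrix.isHermitian_mul_conjTranspose_self P).eigenvalues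
  let pos := Finset.univ.filter fun i => 0 < μ i
  1 - Polynomial.C (∏ i ∈ pos, (μ i : ℂ))⁻¹ *
    ∏ i ∈ pos, (Polynomial.C (μ i : ℂ) - Polynomial.X)

/-- `𝒬_{j,S} = Q_j(P_{j,S} P_{j,S}*)`. -/
def capQ (A : Fin n → Matrix (Fin N) (Fin N) ℂ) (R : Fin k → MvPolynomial (Option (Fin n)) ℂ)
    (m : Fin k → ℕ) (S : Finset (Fin k)) (j : Fin n) : Matrix (Fin N) (Fin N) ℂ :=
  Polynomial.aeval (projP A R m S j * (projP A R m S j)ᴴ) (capPoly (projP A R m S j))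

/-- `M_S = ∑_{s ∈ S} l_s m_s`, where `l_s = deg R_s`. -/
def dimS (R : Fin k → MvPolynomial (Option (Fin n)) ℂ) (m : Fin k → ℕ) (S : Finset (Fin k)) : ℕ :=
  ∑ s ∈ S, (R s).totalDegree * m s

/-- The union of the components `Γ_s = {R_s = 0}`, `s ∈ S`, corresponds to a common invariant
subspace: there is a subspace `M`, invariant under all `A_j`, whose dimension is the total degree
of these components counted with multiplicity, and on which the tuple has the joint spectrum
`⋃_{s ∈ S} Γ_s`. -/
def CorrespondsToInvariantSubspace (A : Fin n → Matrix (Fin N) (Fin N) ℂ)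
    (R : Fin k → MvPolynomial (Option (Fin n)) ℂ) (m : Fin k → ℕ) (S : Finset (Fin k)) : Prop :=
  ∃ (M : Submodule ℂ (Fin N → ℂ)) (hM : ∀ j, ∀ v ∈ M, Matrix.toLin' (A j) v ∈ M),
    Module.finrank ℂ M = dimS R m S ∧
    jointSpectrum (fun j => (Matrix.toLin' (A j)).restrict (hM j)) = ⋃ s ∈ S, zeroLocus (R s)

/-- The polynomial `(x_1 + ⋯ + x_n - x_{n+1})^M x_{n+1}^{M'}`. -/
def planePoly (n M M' : ℕ) : MvPolynomial (Option (Fin n)) ℂ :=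
  (∑ j, MvPolynomial.X (some j) - MvPolynomial.X none) ^ M * MvPolynomial.X none ^ M'

/-- The unilateral shift: `T e_i = e_{i+1}`, `T e_N = 0`. -/
def shift (N : ℕ) : Matrix (Fin N) (Fin N) ℂ :=
  Matrix.of fun a b => if (a : ℕ) = (b : ℕ) + 1 then 1 else 0

/-- The tuple `(A_Λ, T, T*, B_1, …, B_n)`; the index `Sum.inl` holds the first three members. -/
def extTuple (lam : Fin N → ℂ) (B : Fin n → Matrix (Fin N) (Fin N) ℂ) :
    Fin 3 ⊕ Fin n → Matrix (Fin N) (Fin N) ℂ :=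
  Sum.elim ![Matrix.diagonal lam, shift N, (shift N)ᴴ] B

/-- Permutation `τ` of the variables `x_4, …, x_{n+3}` only. -/
def permuteTail (τ : Equiv.Perm (Fin n)) : Equiv.Perm (Option (Fin 3 ⊕ Fin n)) :=
  Equiv.optionCongr (Equiv.sumCongr (Equiv.refl (Fin 3)) τ)

end JointSpec

end

noncomputable section

namespace JointSpec

open Polynomial
open scoped ComplexOrder

/-! ### Functional calculus for Hermitian matrices. -/

section Hermitian
variable {ι : Type*} [Fintype ι] [DecidableEq ι]

/-! All conditions are equivalent to one statement: the matrices `capQ A R m S j` do not depend on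
`j`.

By admissibility the product of the `R s` has only simple zeros on each coordinate line. Hence the
characteristic polynomial of `A j` is a product of coprime factors `q`, `g` carrying the roots that
belong to `S` and to its complement. `projP` is `p(A j)` with `p` congruent to 1 modulo `q` and
divisible by `g`, so it is the Riesz projection for the roots in `S`, and its trace is `dimS`.
`capQ` is the orthogonal projection onto the range of `projP`.

From (a): on `M` the operator `g(A j)` is invertible, so `q(A j) = 0` there by Cayley–Hamilton, and
`projP` and `capQ` fix `M`. Comparing dimensions, every `capQ` is the orthogonal projection onto
`M`. Coinciding projections give (b′), (b) and (c) by direct computation.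

From (b): the sum `T` of the projections has eigenvalues only in `{0, n}`, so `T² = nT`, and then
the squared Hilbert–Schmidt distances between the projections add up to zero
(`forall_eq_of_eigenvalues`).

From (c): a transposition of tail variables shows that `A_Λ + uT + yQ_i` and `A_Λ + uT + yQ_j` (`T`
the shift) have equal spectra. For small `u`, `y` these are simple, so the characteristic
polynomials agree. The derivative in `y` says that `Q_i - Q_j` is trace-orthogonal to the resolvents
of `A_Λ + uT`; these detect every entry on or above the diagonal (`eq_zero_of_trace_resolvent`), and
hermiticity gives the rest.

Back to (a): the common range is invariant under every `A i`, and the determinant of the pencil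
splits into a restriction factor and a quotient factor. One zero of `R s` on a coordinate line
decides which factor `R s` divides: the first exactly when `s ∈ S` (`dvd_detRestrict_iff`). -/

theorem aeval_diagonal (d : ι → ℂ) (p : ℂ[X]) :
    aeval (Matrix.diagonal d) p = Matrix.diagonal fun i => p.eval (d i) := by
  have h := Polynomial.aeval_algHom_apply (Matrix.diagonalAlgHom ℂ (n := ι) (α := ℂ)) d p
  rw [Matrix.diagonalAlgHom_apply, Matrix.diagonalAlgHom_apply] at h
  rw [h]
  congr 1
  ext i
  simp

theorem aeval_isHermitian {H : Matrix ι ι ℂ} (hH : H.IsHermitian) (p : ℂ[X]) :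
    aeval H p = Unitary.conjStarAlgAut ℂ _ hH.eigenvectorUnitary
      (Matrix.diagonal fun i => p.eval (hH.eigenvalues i : ℂ)) := by
  conv_lhs => rw [hH.spectral_theorem]
  have h := Polynomial.aeval_algHom_apply
    ((Unitary.conjStarAlgAut ℂ (Matrix ι ι ℂ) hH.eigenvectorUnitary : _ ≃⋆ₐ[ℂ] _) :
      Matrix ι ι ℂ →ₐ[ℂ] Matrix ι ι ℂ)
    (Matrix.diagonal (RCLike.ofReal ∘ hH.eigenvalues)) p
  rw [aeval_diagonal] at h
  exact h

theorem aeval_isHermitian_eq_zero {H : Matrix ι ι ℂ} (hH : H.IsHermitian) (p : ℂ[X])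
    (hp : ∀ i, p.eval (hH.eigenvalues i : ℂ) = 0) : aeval H p = 0 := by
  rw [aeval_isHermitian hH]
  simp [hp]

theorem isHermitian_aeval {H : Matrix ι ι ℂ} (hH : H.IsHermitian) (p : ℂ[X])
    (hp : ∀ i, star (p.eval (hH.eigenvalues i : ℂ)) = p.eval (hH.eigenvalues i : ℂ)) :
    (aeval H p).IsHermitian := by
  rw [aeval_isHermitian hH, Matrix.IsHermitian, ← Matrix.star_eq_conjTranspose, ← map_star,
    Matrix.star_eq_conjTranspose, Matrix.diagonal_conjTranspose]
  congr 2
  ext i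
  exact hp i

theorem not_isUnit_sub_eigenvalue {H : Matrix ι ι ℂ} (hH : H.IsHermitian) (i : ι) :
    ¬ IsUnit (H - (hH.eigenvalues i : ℂ) • (1 : Matrix ι ι ℂ)) := by
  intro h
  have h1 : H - (hH.eigenvalues i : ℂ) • (1 : Matrix ι ι ℂ) =
      aeval H (X - C (hH.eigenvalues i : ℂ)) := by
    simp [Algebra.algebraMap_eq_smul_one]
  rw [h1, aeval_isHermitian hH] at h
  have h2 := (MulEquiv.isUnit_map (Unitary.conjStarAlgAut ℂ (Matrix ι ι ℂ) hH.eigenvectorUnitary)).1 h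
  rw [Matrix.isUnit_iff_isUnit_det, Matrix.det_diagonal, isUnit_iff_ne_zero,
    Finset.prod_ne_zero_iff] at h2
  exact h2 i (Finset.mem_univ _) (by simp)

end Hermitian

/-! ### The orthogonal projection onto the range of a matrix. -/

section Cap
variable {N : ℕ} (P : Matrix (Fin N) (Fin N) ℂ)

/-- Together with the value 1 at the positive eigenvalues, this makes `capPoly` the indicator of the
nonzero spectrum of `P Pᴴ`. -/
theorem eval_capPoly_zero : (capPoly P).eval 0 = 0 := by
  have h : (∏ i ∈ Finset.univ.filter fun i =>
      0 < (Matrix.isHermitian_mul_conjTranspose_self P).eigenvalues i,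
      ((Matrix.isHermitian_mul_conjTranspose_self P).eigenvalues i : ℂ)) ≠ 0 := by
    rw [Finset.prod_ne_zero_iff]
    intro i hi
    have := (Finset.mem_filter.1 hi).2
    exact_mod_cast this.ne'
  simp only [capPoly, eval_sub, eval_mul, eval_one, eval_C, eval_prod, eval_X, sub_zero]
  rw [inv_mul_cancel₀ h, sub_self]

theorem eval_capPoly_of_pos (i : Fin N)
    (hi : 0 < (Matrix.isHermitian_mul_conjTranspose_self P).eigenvalues i) :
    (capPoly P).eval ((Matrix.isHermitian_mul_conjTranspose_self P).eigenvalues i : ℂ) = 1 := by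
  simp only [capPoly, eval_sub, eval_mul, eval_one, eval_C, eval_prod, eval_X]
  have h : i ∈ Finset.univ.filter fun i =>
      0 < (Matrix.isHermitian_mul_conjTranspose_self P).eigenvalues i := by simpa using hi
  rw [Finset.prod_eq_zero (f := fun x =>
    (((Matrix.isHermitian_mul_conjTranspose_self P).eigenvalues x : ℂ) -
      ((Matrix.isHermitian_mul_conjTranspose_self P).eigenvalues i : ℂ))) h (sub_self _),
    mul_zero, sub_zero]

theorem eigenvalues_eq_zero_or_pos (i : Fin N) :
    (Matrix.isHermitian_mul_conjTranspose_self P).eigenvalues i = 0 ∨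
    0 < (Matrix.isHermitian_mul_conjTranspose_self P).eigenvalues i := by
  have := (Matrix.posSemidef_self_mul_conjTranspose P).eigenvalues_nonneg i
  rcases this.lt_or_eq with h | h
  · exact Or.inr h
  · exact Or.inl h.symm

/-- The orthogonal projection onto the range of `P`, as a polynomial in `P Pᴴ`. -/
def capProj : Matrix (Fin N) (Fin N) ℂ := aeval (P * Pᴴ) (capPoly P)

theorem capProj_isHermitian : (capProj P).IsHermitian := by
  refine isHermitian_aeval (Matrix.isHermitian_mul_conjTranspose_self P) _ fun i => ?_
  rcases eigenvalues_eq_zero_or_pos P i with h | h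
  · simp [h, eval_capPoly_zero]
  · simp [eval_capPoly_of_pos P i h]

theorem capProj_mul : capProj P * P = P := by
  have h1 : (1 - capProj P) * (P * Pᴴ) = 0 := by
    have := aeval_isHermitian_eq_zero (Matrix.isHermitian_mul_conjTranspose_self P)
      ((1 - capPoly P) * X) (fun i => by
        rcases eigenvalues_eq_zero_or_pos P i with h | h
        · simp [h]
        · simp [eval_capPoly_of_pos P i h])
    simpa [capProj] using this
  -- Passing from `P Pᴴ` to `P`: a matrix `B` with `B Bᴴ = 0` vanishes.
  have h2 : ((1 - capProj P) * P) * ((1 - capProj P) * P)ᴴ = 0 := by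
    rw [Matrix.conjTranspose_mul, ← mul_assoc, mul_assoc _ P, h1, zero_mul]
  rw [Matrix.self_mul_conjTranspose_eq_zero, sub_mul, one_mul, sub_eq_zero] at h2
  exact h2.symm

theorem exists_capProj_eq_mul : ∃ B, capProj P = P * B := by
  have h : X ∣ capPoly P := by
    rw [Polynomial.X_dvd_iff, Polynomial.coeff_zero_eq_eval_zero, eval_capPoly_zero]
  obtain ⟨r, hr⟩ := h
  refine ⟨Pᴴ * aeval (P * Pᴴ) r, ?_⟩
  rw [capProj, hr, map_mul, aeval_X, mul_assoc]

theorem capProj_mul_self : capProj P * capProj P = capProj P := by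
  obtain ⟨B, hB⟩ := exists_capProj_eq_mul P
  nth_rewrite 2 [hB]
  rw [← mul_assoc, capProj_mul, ← hB]

variable {P}

theorem mul_capProj (hP : P * P = P) : P * capProj P = capProj P := by
  obtain ⟨B, hB⟩ := exists_capProj_eq_mul P
  rw [hB, ← mul_assoc, hP]

/-- Two idempotents with the same range satisfy `PQ = Q` and `QP = P`, so cyclicity of the trace
suffices. -/
theorem trace_capProj (hP : P * P = P) : (capProj P).trace = P.trace := by
  rw [← mul_capProj hP, Matrix.trace_mul_comm, capProj_mul]

end Cap

/-! ### Determinant and trace of a polynomial in a matrix. -/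

section DetAeval
variable {ι : Type*} [Fintype ι] [DecidableEq ι]

theorem charpoly_eq_prod_roots (A : Matrix ι ι ℂ) :
    A.charpoly = (A.charpoly.roots.map fun l => X - C l).prod :=
  (IsAlgClosed.splits A.charpoly).eq_prod_roots_of_monic A.charpoly_monic

theorem card_roots_charpoly (A : Matrix ι ι ℂ) :
    Multiset.card A.charpoly.roots = Fintype.card ι := by
  rw [← (IsAlgClosed.splits A.charpoly).natDegree_eq_card_roots, A.charpoly_natDegree_eq_dim]

theorem det_aeval_sub (A : Matrix ι ι ℂ) (c : ℂ) :
    (aeval A (X - C c)).det = (A.charpoly.roots.map fun l => l - c).prod := by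
  have h1 : aeval A (X - C c) = -(Matrix.scalar ι c - A) := by
    simp [Matrix.scalar_apply, Matrix.algebraMap_eq_diagonal]
  rw [h1, Matrix.det_neg, ← Matrix.eval_charpoly]
  conv_lhs => rw [charpoly_eq_prod_roots A]
  rw [eval_multiset_prod, Multiset.map_map, ← card_roots_charpoly A, ← Multiset.card_map
    (fun l => c - l) A.charpoly.roots]
  have : (fun l : ℂ => l - c) = Neg.neg ∘ fun l => c - l := by ext; simp
  rw [this, ← Multiset.map_map Neg.neg (fun l => c - l), Multiset.prod_map_neg]
  simp

/-- The spectral mapping theorem for the determinant. -/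
theorem det_aeval (A : Matrix ι ι ℂ) (r : ℂ[X]) :
    (aeval A r).det = (A.charpoly.roots.map fun l => r.eval l).prod := by
  have key : ∀ s : Multiset ℂ, (aeval A (s.map fun c => X - C c).prod).det =
      (A.charpoly.roots.map fun l => ((s.map fun c => X - C c).prod).eval l).prod := by
    intro s
    induction s using Multiset.induction_on with
    | empty => simp
    | cons c s ih =>
      rw [Multiset.map_cons, Multiset.prod_cons, map_mul, Matrix.det_mul, ih, det_aeval_sub,
        ← Multiset.prod_map_mul]
      simp
  rw [(IsAlgClosed.splits r).eq_prod_roots, map_mul, Matrix.det_mul, key, aeval_C,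
    Matrix.algebraMap_eq_diagonal, Matrix.det_diagonal]
  simp only [eval_mul, eval_C]
  rw [Multiset.prod_map_mul, Multiset.map_const', Multiset.prod_replicate, card_roots_charpoly]
  simp

theorem trace_aeval (A : Matrix ι ι ℂ) (p : ℂ[X]) :
    (aeval A p).trace = (A.charpoly.roots.map fun l => p.eval l).sum := by
  -- The determinant formula for `y - p`, for every `y`, yields all eigenvalues of `p(A)` with
  -- multiplicity.
  have h : (aeval A p).charpoly = (A.charpoly.roots.map fun l => X - C (p.eval l)).prod := by
    refine Polynomial.funext fun y => ?_
    rw [Matrix.eval_charpoly, eval_multiset_prod, Multiset.map_map]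
    have : Matrix.scalar ι y - aeval A p = aeval A (C y - p) := by
      simp [Matrix.scalar_apply, Matrix.algebraMap_eq_diagonal]
    rw [this, det_aeval]
    simp
  rw [Matrix.trace_eq_sum_roots_charpoly, h]
  congr 1
  have := Polynomial.roots_multiset_prod_X_sub_C (A.charpoly.roots.map fun l => p.eval l)
  rwa [Multiset.map_map] at this

theorem eval_mem_of_aeval_eq_zero (A : Matrix ι ι ℂ) {p : ℂ[X]} (hp : aeval A p = 0) {l : ℂ}
    (hl : l ∈ A.charpoly.roots) : p.eval l = 0 := by
  have hl' : l ∈ spectrum ℂ A :=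
    Matrix.mem_spectrum_of_isRoot_charpoly (isRoot_of_mem_roots hl)
  by_cases hn : Nonempty ι
  · have := spectrum.subset_polynomial_aeval A p ⟨l, hl', rfl⟩
    rw [hp, spectrum.zero_eq] at this
    exact this
  · rw [not_nonempty_iff] at hn
    simp [Matrix.charpoly] at hl

/-- The determinant of the pencil of one idempotent matrix. -/
theorem det_idempotent_pencil {Q : Matrix ι ι ℂ} (hQ : Q * Q = Q) {M : ℕ} (hM : Q.trace = M)
    (a b : ℂ) : M ≤ Fintype.card ι ∧
    (a • Q - b • (1 : Matrix ι ι ℂ)).det = (a - b) ^ M * (-b) ^ (Fintype.card ι - M) := by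
  have h01 : ∀ l ∈ Q.charpoly.roots, l = 1 ∨ l = 0 := by
    intro l hl
    have := eval_mem_of_aeval_eq_zero Q (p := X * X - X) (by simp [hQ]) hl
    simp only [eval_sub, eval_mul, eval_X] at this
    have h : (l - 1) * l = 0 := by linear_combination this
    rcases mul_eq_zero.1 h with h | h
    · left; linear_combination h
    · right; exact h
  have hrep : ∀ s : Multiset ℂ, (∀ l ∈ s, l = 1 ∨ l = 0) →
      ∃ u v, s = Multiset.replicate u 1 + Multiset.replicate v 0 := by
    intro s
    induction s using Multiset.induction_on with
    | empty => exact fun _ => ⟨0, 0, by simp⟩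
    | cons c s ih =>
      intro h
      obtain ⟨u, v, rfl⟩ := ih fun l hl => h l (Multiset.mem_cons_of_mem hl)
      rcases h c (Multiset.mem_cons_self _ _) with rfl | rfl
      · exact ⟨u + 1, v, by rw [Multiset.replicate_succ, Multiset.cons_add]⟩
      · exact ⟨u, v + 1, by rw [Multiset.replicate_succ, Multiset.add_cons]⟩
  -- The spectrum consists of `u` ones and `v` zeros; the trace identifies `u` with `M`.
  obtain ⟨u, v, huv⟩ := hrep _ h01
  have hu : u = M := by
    have := Matrix.trace_eq_sum_roots_charpoly (A := Q)
    rw [hM, huv] at this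
    simp at this
    exact_mod_cast this.symm
  have hv : u + v = Fintype.card ι := by
    rw [← card_roots_charpoly Q, huv]; simp
  subst hu
  refine ⟨by omega, ?_⟩
  have h1 : a • Q - b • (1 : Matrix ι ι ℂ) = aeval Q (C a * X - C b) := by
    simp [Algebra.algebraMap_eq_smul_one]
  rw [h1, det_aeval, huv, ← hv]
  simp

end DetAeval

/-! ### Riesz projections as polynomials in a matrix. -/

section Riesz
variable {ι : Type*} [Fintype ι] [DecidableEq ι] {A : Matrix ι ι ℂ} {q g p : ℂ[X]}

theorem aeval_mul_aeval_eq_zero (hA : A.charpoly = q * g) (hg : g ∣ p) :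
    aeval A q * aeval A p = 0 := by
  obtain ⟨r, rfl⟩ := hg
  rw [← map_mul, ← mul_assoc, ← hA, map_mul, Matrix.aeval_self_charpoly, zero_mul]

/-- The characteristic polynomial `q * g` divides `(1 - p) * p`, so Cayley–Hamilton applies. -/
theorem riesz_mul_self (hA : A.charpoly = q * g) (hq : q ∣ 1 - p) (hg : g ∣ p) :
    aeval A p * aeval A p = aeval A p := by
  obtain ⟨r, hr⟩ := hq
  have h : aeval A (1 - p) * aeval A p = 0 := by
    rw [hr, mul_comm q r, map_mul, mul_assoc, aeval_mul_aeval_eq_zero hA hg, mul_zero]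
  rw [map_sub, map_one, sub_mul, one_mul, sub_eq_zero] at h
  exact h.symm

theorem riesz_mul_eq (hq : q ∣ 1 - p) {B : Matrix ι ι ℂ} (hB : aeval A q * B = 0) :
    aeval A p * B = B := by
  obtain ⟨r, hr⟩ := hq
  have h : aeval A (1 - p) * B = 0 := by
    rw [hr, mul_comm, map_mul, mul_assoc, hB, mul_zero]
  rw [map_sub, map_one, sub_mul, one_mul, sub_eq_zero] at h
  exact h.symm

theorem riesz_trace (hA : A.charpoly = q * g) (hq : q ∣ 1 - p) (hg : g ∣ p) :
    (aeval A p).trace = q.natDegree := by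
  have h0 : q * g ≠ 0 := hA ▸ A.charpoly_monic.ne_zero
  rw [trace_aeval, hA, roots_mul h0, Multiset.map_add, Multiset.sum_add]
  have h1 : ∀ l ∈ q.roots, p.eval l = 1 := by
    intro l hl
    have := eval_eq_zero_of_dvd_of_eval_eq_zero hq (isRoot_of_mem_roots hl)
    simp only [eval_sub, eval_one] at this
    linear_combination -this
  have h2 : ∀ l ∈ g.roots, p.eval l = 0 := fun l hl =>
    eval_eq_zero_of_dvd_of_eval_eq_zero hg (isRoot_of_mem_roots hl)
  rw [Multiset.map_congr rfl h1, Multiset.map_congr rfl h2,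
    (IsAlgClosed.splits q).natDegree_eq_card_roots]
  simp

end Riesz

/-! ### Factors of homogeneous polynomials. -/

section Homogeneous
variable {σ : Type*}

/-- The substitution `X i ↦ X i * T`, which records the homogeneous components of a polynomial as
the coefficients of the powers of `T`. -/
def grade : MvPolynomial σ ℂ →ₐ[ℂ] (MvPolynomial σ ℂ)[X] :=
  MvPolynomial.aeval fun i => C (MvPolynomial.X i) * X

theorem grade_monomial (s : σ →₀ ℕ) (a : ℂ) :
    grade (MvPolynomial.monomial s a) = C (MvPolynomial.monomial s a) * X ^ s.degree := by
  rw [grade, MvPolynomial.aeval_monomial, MvPolynomial.monomial_eq]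
  simp only [Finsupp.prod, mul_pow, Finset.prod_mul_distrib, Finsupp.degree_apply,
    Finset.prod_pow_eq_pow_sum, map_mul, map_prod, map_pow]
  rw [mul_assoc]
  congr 1

theorem coeff_grade (f : MvPolynomial σ ℂ) (d : ℕ) :
    (grade f).coeff d = MvPolynomial.homogeneousComponent d f := by
  induction f using MvPolynomial.induction_on' with
  | monomial s a =>
    rw [grade_monomial, coeff_C_mul_X_pow]
    split_ifs with h
    · subst h
      exact ((MvPolynomial.homogeneousComponent_of_mem
        (MvPolynomial.isHomogeneous_monomial a rfl)).trans (if_pos rfl)).symm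
    · exact ((MvPolynomial.homogeneousComponent_of_mem
        (MvPolynomial.isHomogeneous_monomial a rfl)).trans (if_neg h)).symm
  | add p q hp hq => rw [map_add, coeff_add, hp, hq, map_add]

theorem grade_of_isHomogeneous {f : MvPolynomial σ ℂ} {n : ℕ} (hf : f.IsHomogeneous n) :
    grade f = C f * X ^ n := by
  ext1 d
  rw [coeff_grade, coeff_C_mul_X_pow, MvPolynomial.homogeneousComponent_of_mem hf]

theorem grade_ne_zero {f : MvPolynomial σ ℂ} (hf : f ≠ 0) : grade f ≠ 0 := by
  intro h
  apply hf
  rw [← MvPolynomial.sum_homogeneousComponent f]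
  refine Finset.sum_eq_zero fun d _ => ?_
  rw [← coeff_grade, h, coeff_zero]

/-- A factor of a nonzero homogeneous polynomial is homogeneous. -/
theorem isHomogeneous_of_dvd {f h : MvPolynomial σ ℂ} {n : ℕ} (hh : h.IsHomogeneous n)
    (h0 : h ≠ 0) (hf : f ∣ h) : f.IsHomogeneous f.totalDegree := by
  obtain ⟨g, rfl⟩ := hf
  have hf0 := left_ne_zero_of_mul h0
  have h1 := grade_of_isHomogeneous hh
  rw [map_mul] at h1
  -- Degree and trailing degree in `T` are both additive and agree on the product, which is a
  -- monomial in `T`; hence they agree on each factor.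
  have h2 := natDegree_mul (grade_ne_zero hf0) (grade_ne_zero (right_ne_zero_of_mul h0))
  have h3 := natTrailingDegree_mul (grade_ne_zero hf0) (grade_ne_zero (right_ne_zero_of_mul h0))
  rw [h1, natDegree_C_mul_X_pow _ _ h0] at h2
  rw [h1, C_mul_X_pow_eq_monomial, natTrailingDegree_monomial h0] at h3
  have h4 := natTrailingDegree_le_natDegree (grade f)
  have h5 := natTrailingDegree_le_natDegree (grade g)
  have h6 : (grade f).natDegree = (grade f).natTrailingDegree := by omega
  have h7 : f.IsHomogeneous (grade f).natDegree := by
    intro s hs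
    change Finsupp.weight (fun _ => 1) s = _
    rw [← Finsupp.degree_eq_weight_one]
    have h8 : (grade f).coeff s.degree ≠ 0 := by
      rw [coeff_grade]
      intro h9
      apply hs
      have := congrArg (MvPolynomial.coeff s) h9
      rwa [MvPolynomial.coeff_homogeneousComponent, if_pos rfl, MvPolynomial.coeff_zero] at this
    have h10 := le_natDegree_of_ne_zero h8
    have h11 := natTrailingDegree_le_of_ne_zero h8
    change s.degree = _
    omega
  rwa [h7.totalDegree hf0]

theorem eval_smul_of_isHomogeneous {f : MvPolynomial σ ℂ} {n : ℕ} (hf : f.IsHomogeneous n)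
    (c : ℂ) (x : σ → ℂ) :
    MvPolynomial.eval (c • x) f = c ^ n * MvPolynomial.eval x f := by
  rw [MvPolynomial.eval_eq, MvPolynomial.eval_eq, Finset.mul_sum]
  refine Finset.sum_congr rfl fun s hs => ?_
  simp only [Pi.smul_apply, smul_eq_mul, mul_pow, Finset.prod_mul_distrib]
  rw [Finset.prod_pow_eq_pow_sum, ← hf.degree_eq_sum_deg_support hs]
  ring

end Homogeneous

/-! ### The determinant of the pencil. -/

section Pencil
variable {κ : Type*} [Fintype κ] {N : ℕ}

theorem eval_detPencil (A : κ → Matrix (Fin N) (Fin N) ℂ) (x : Option κ → ℂ) :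
    MvPolynomial.eval x (detPencil A) = (pencil A x).det := by
  rw [detPencil, RingHom.map_det]
  congr 1
  ext a b
  by_cases h : a = b <;> simp [pencil, Matrix.sum_apply, h]

theorem isHomogeneous_detPencil (A : κ → Matrix (Fin N) (Fin N) ℂ) :
    (detPencil A).IsHomogeneous N := by
  rw [detPencil, Matrix.det_apply]
  refine MvPolynomial.IsHomogeneous.sum _ _ _ fun σ _ => ?_
  rw [Units.smul_def, zsmul_eq_mul]
  have h1 : (((Equiv.Perm.sign σ : ℤˣ) : ℤ) : MvPolynomial (Option κ) ℂ).IsHomogeneous 0 := by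
    have := MvPolynomial.isHomogeneous_C (σ := Option κ) (((Equiv.Perm.sign σ : ℤˣ) : ℤ) : ℂ)
    simpa using this
  have h2 := MvPolynomial.IsHomogeneous.prod (Finset.univ : Finset (Fin N))
    (fun i => (∑ j, (MvPolynomial.X (some j) : MvPolynomial (Option κ) ℂ) •
      (A j).map (MvPolynomial.C : ℂ →+* MvPolynomial (Option κ) ℂ)
    - (MvPolynomial.X none : MvPolynomial (Option κ) ℂ) • 1) (σ i) i) (fun _ => 1) (by
      intro i _
      rw [Matrix.sub_apply, Matrix.sum_apply]
      refine MvPolynomial.IsHomogeneous.sub ?_ ?_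
      · refine MvPolynomial.IsHomogeneous.sum _ _ _ fun j _ => ?_
        rw [Matrix.smul_apply, Matrix.map_apply, smul_eq_mul, mul_comm]
        exact MvPolynomial.isHomogeneous_C_mul_X _ _
      · rw [Matrix.smul_apply, Matrix.one_apply, smul_eq_mul]
        split_ifs
        · simpa using MvPolynomial.isHomogeneous_X ℂ _
        · simpa using MvPolynomial.isHomogeneous_zero _ _ _)
  simpa using h1.mul h2

theorem detPencil_ne_zero (A : κ → Matrix (Fin N) (Fin N) ℂ) : detPencil A ≠ 0 := by
  intro h
  have h1 := eval_detPencil A (fun o => o.elim 1 fun _ => 0)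
  rw [h, map_zero] at h1
  have : pencil A (fun o => o.elim 1 fun _ => 0) = -1 := by simp [pencil]
  rw [this, Matrix.det_neg, Matrix.det_one, mul_one] at h1
  exact pow_ne_zero _ (neg_ne_zero.2 one_ne_zero) h1.symm

end Pencil

/-! ### Restriction to the coordinate lines. -/

section Line
variable {n : ℕ}

/-- Restriction of a polynomial to the points `(0, …, 1, …, 0, z)`. -/
def lineHom (j : Fin n) : MvPolynomial (Option (Fin n)) ℂ →ₐ[ℂ] ℂ[X] :=
  MvPolynomial.aeval (fun o : Option (Fin n) => match o with
    | none => (Polynomial.X : Polynomial ℂ)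
    | some i => if i = j then 1 else 0)

theorem lineRoots_eq {k : ℕ} (R : Fin k → MvPolynomial (Option (Fin n)) ℂ) (j : Fin n)
    (s : Fin k) : lineRoots R j s = (lineHom j (R s)).roots.toFinset := rfl

theorem eval_lineHom (j : Fin n) (F : MvPolynomial (Option (Fin n)) ℂ) (z : ℂ) :
    (lineHom j F).eval z = MvPolynomial.eval (linePoint j 1 z) F := by
  induction F using MvPolynomial.induction_on with
  | C a => simp [lineHom]
  | add p q hp hq => simp [hp, hq]
  | mul_X p i hp =>
    rw [map_mul, eval_mul, hp, map_mul, MvPolynomial.eval_X]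
    congr 1
    cases i with
    | none => simp [lineHom, linePoint]
    | some i => simp [lineHom, linePoint]; split_ifs <;> simp

theorem derivative_lineHom (j : Fin n) (F : MvPolynomial (Option (Fin n)) ℂ) :
    derivative (lineHom j F) = lineHom j (MvPolynomial.pderiv none F) := by
  induction F using MvPolynomial.induction_on with
  | C a => simp [lineHom]
  | add p q hp hq => simp [hp, hq]
  | mul_X p i hp =>
    have hX : derivative (lineHom j (MvPolynomial.X i)) =
        lineHom j (MvPolynomial.pderiv none (MvPolynomial.X i)) := by
      cases i with
      | none => simp [lineHom]
      | some i =>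
        rw [MvPolynomial.pderiv_X_of_ne (by simp), map_zero, lineHom, MvPolynomial.aeval_X]
        dsimp only
        split_ifs <;> simp
    rw [map_mul, derivative_mul, hp, hX, MvPolynomial.pderiv_mul, map_add, map_mul, map_mul]

theorem natDegree_lineHom_le (j : Fin n) (F : MvPolynomial (Option (Fin n)) ℂ) :
    (lineHom j F).natDegree ≤ F.totalDegree := by
  rw [lineHom]
  refine (MvPolynomial.aeval_natDegree_le (m := F.totalDegree) (n := 1) F le_rfl _ ?_).trans
    (mul_one _).le
  rintro (_ | i)
  · simp
  · dsimp only; split_ifs <;> simp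

theorem pencil_linePoint {𝒜 : Type*} [Ring 𝒜] [Algebra ℂ 𝒜] (A : Fin n → 𝒜) (j : Fin n)
    (u v : ℂ) : pencil A (linePoint j u v) = u • A j - v • (1 : 𝒜) := by
  simp [pencil, linePoint, ite_smul]

theorem lineHom_detPencil {N : ℕ} (A : Fin n → Matrix (Fin N) (Fin N) ℂ) (j : Fin n) :
    lineHom j (detPencil A) = C ((-1) ^ N) * (A j).charpoly := by
  refine Polynomial.funext fun z => ?_
  rw [eval_lineHom, eval_detPencil, pencil_linePoint, eval_mul, Matrix.eval_charpoly, eval_C]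
  have : (1 : ℂ) • A j - z • (1 : Matrix (Fin N) (Fin N) ℂ) = -(Matrix.scalar (Fin N) z - A j) := by
    rw [Matrix.scalar_apply, ← Matrix.smul_one_eq_diagonal, one_smul, neg_sub]
  rw [this, Matrix.det_neg, Fintype.card_fin]

end Line

/-! ### Consequences of the factorization and of admissibility. -/

section

variable {n N k : ℕ} {A : Fin n → Matrix (Fin N) (Fin N) ℂ}
  {R : Fin k → MvPolynomial (Option (Fin n)) ℂ} {m : Fin k → ℕ}

namespace IsFactorization

variable (hfac : IsFactorization A R m)
include hfac

theorem dvd_detPencil (s : Fin k) : R s ∣ detPencil A := by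
  rw [hfac.det_eq]
  exact (dvd_pow_self _ (hfac.mult_pos s).ne').trans (Finset.dvd_prod_of_mem _ (Finset.mem_univ s))

theorem isHomogeneous (s : Fin k) : (R s).IsHomogeneous (R s).totalDegree :=
  isHomogeneous_of_dvd (isHomogeneous_detPencil A) (detPencil_ne_zero A) (hfac.dvd_detPencil s)

theorem sum_totalDegree : ∑ s, (R s).totalDegree * m s = N := by
  have h := MvPolynomial.IsHomogeneous.prod Finset.univ (fun s => R s ^ m s)
    (fun s => (R s).totalDegree * m s) fun s _ => (hfac.isHomogeneous s).pow (m s)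
  rw [← hfac.det_eq] at h
  exact h.inj_right (isHomogeneous_detPencil A) (detPencil_ne_zero A)

theorem dimS_le (S : Finset (Fin k)) : dimS R m S ≤ N := by
  rw [← hfac.sum_totalDegree, dimS]
  exact Finset.sum_le_sum_of_subset (Finset.subset_univ S)

theorem lineHom_ne_zero (j : Fin n) (s : Fin k) : lineHom j (R s) ≠ 0 := by
  intro h
  have h1 := map_dvd (lineHom j) (hfac.dvd_detPencil s)
  rw [h, zero_dvd_iff, lineHom_detPencil] at h1
  exact mul_ne_zero (C_ne_zero.2 (pow_ne_zero _ (neg_ne_zero.2 one_ne_zero)))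
    (A j).charpoly_monic.ne_zero h1

theorem associated_charpoly (j : Fin n) :
    Associated (A j).charpoly (∏ s, lineHom j (R s) ^ m s) := by
  have h := lineHom_detPencil A j
  rw [hfac.det_eq, map_prod] at h
  simp only [map_pow (lineHom j)] at h
  rw [h]
  refine (associated_unit_mul_left _ _ ?_).symm
  exact isUnit_C.2 (isUnit_iff_ne_zero.2 (pow_ne_zero _ (neg_ne_zero.2 one_ne_zero)))

/-- No degree is lost on the line: each degree is at most `totalDegree`, while the sums weighted by
the positive `m s` both equal `N`. -/
theorem natDegree_lineHom (j : Fin n) (s : Fin k) :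
    (lineHom j (R s)).natDegree = (R s).totalDegree := by
  have h1 : ∑ s, (lineHom j (R s)).natDegree * m s = N := by
    have h := natDegree_eq_of_degree_eq (degree_eq_degree_of_associated (hfac.associated_charpoly j))
    rw [Matrix.charpoly_natDegree_eq_dim, Fintype.card_fin, natDegree_prod _ _ fun s _ =>
      pow_ne_zero _ (hfac.lineHom_ne_zero j s)] at h
    rw [h]
    exact Finset.sum_congr rfl fun s _ => by rw [natDegree_pow, mul_comm]
  rw [← hfac.sum_totalDegree] at h1
  have h2 := (Finset.sum_eq_sum_iff_of_le fun s _ =>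
    Nat.mul_le_mul_right (m s) (natDegree_lineHom_le j (R s))).1 h1 s (Finset.mem_univ s)
  exact Nat.eq_of_mul_eq_mul_right (hfac.mult_pos s) h2

theorem eval_det_eq_zero {x : Option (Fin n) → ℂ} (hx : MvPolynomial.eval x (∏ s, R s) = 0) :
    (pencil A x).det = 0 := by
  rw [map_prod, Finset.prod_eq_zero_iff] at hx
  obtain ⟨s, -, hs⟩ := hx
  rw [← eval_detPencil]
  obtain ⟨g, hg⟩ := hfac.dvd_detPencil s
  rw [hg, map_mul, hs, zero_mul]

theorem isHomogeneous_prod :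
    (∏ s, R s).IsHomogeneous (∑ s, (R s).totalDegree) :=
  MvPolynomial.IsHomogeneous.prod Finset.univ R _ fun s _ => hfac.isHomogeneous s

variable (hadm : Admissible A R)
include hadm

theorem derivative_ne_zero (j : Fin n) {z : ℂ} (hz : (lineHom j (∏ s, R s)).eval z = 0) :
    (derivative (lineHom j (∏ s, R s))).eval z ≠ 0 := by
  rw [derivative_lineHom, eval_lineHom]
  rw [eval_lineHom] at hz
  by_cases h0 : z = 0
  · subst h0
    refine hadm.regular_infty j ?_
    have h := hfac.eval_det_eq_zero hz
    rw [pencil_linePoint, one_smul, zero_smul, sub_zero] at h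
    rw [Matrix.isUnit_iff_isUnit_det, h]
    exact not_isUnit_zero
  · have hpt : linePoint j z⁻¹ 1 = z⁻¹ • linePoint j 1 z := by
      ext o
      cases o with
      | none => simp [linePoint, h0]
      | some i => simp [linePoint]
    have hF := hfac.isHomogeneous_prod
    have hz' : MvPolynomial.eval (linePoint j z⁻¹ 1) (∏ s, R s) = 0 := by
      rw [hpt, eval_smul_of_isHomogeneous hF, hz, mul_zero]
    have h1 : MvPolynomial.eval (linePoint j z⁻¹ 1) (MvPolynomial.pderiv (some j) (∏ s, R s)) ≠ 0 := by
      refine hadm.regular j z⁻¹ ?_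
      rw [Matrix.isUnit_iff_isUnit_det, hfac.eval_det_eq_zero hz']
      exact not_isUnit_zero
    -- Euler's relation at a zero of the product. Only the coordinates `j` and `none` are nonzero
    -- there, so if the derivative in the last variable vanished, the one in `x_j` would too,
    -- against admissibility.
    have h2 := congrArg (MvPolynomial.eval (linePoint j z⁻¹ 1)) hF.sum_X_mul_pderiv
    rw [map_nsmul, hz', smul_zero, map_sum, Fintype.sum_option, Finset.sum_eq_single j] at h2
    · intro h3
      rw [hpt, map_mul, eval_smul_of_isHomogeneous hF.pderiv, h3, mul_zero, mul_zero, zero_add,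
        ← hpt, map_mul, MvPolynomial.eval_X, mul_eq_zero] at h2
      rcases h2 with h2 | h2
      · simp [linePoint, h0] at h2
      · exact h1 h2
    · intro i _ hi
      simp [linePoint, hi]
    · simp

theorem nodup_roots (j : Fin n) : (lineHom j (∏ s, R s)).roots.Nodup := by
  rw [Multiset.nodup_iff_count_le_one]
  intro z
  rw [count_roots]
  by_contra! h
  have h0 : lineHom j (∏ s, R s) ≠ 0 := by
    rw [map_prod, Finset.prod_ne_zero_iff]
    exact fun s _ => hfac.lineHom_ne_zero j s
  have := (one_lt_rootMultiplicity_iff_isRoot h0).1 h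
  exact hfac.derivative_ne_zero hadm j this.1 this.2

theorem nodup_roots_lineHom (j : Fin n) (s : Fin k) : (lineHom j (R s)).roots.Nodup := by
  have h0 : lineHom j (∏ s, R s) ≠ 0 := by
    rw [map_prod, Finset.prod_ne_zero_iff]
    exact fun s _ => hfac.lineHom_ne_zero j s
  have h1 : R s ∣ ∏ s, R s := Finset.dvd_prod_of_mem _ (Finset.mem_univ s)
  have h2 := map_dvd (lineHom j) h1
  have h3 := roots.le_of_dvd h0 h2
  exact Multiset.nodup_of_le h3 (hfac.nodup_roots hadm j)

theorem card_lineRoots (j : Fin n) (s : Fin k) :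
    (lineRoots R j s).card = (R s).totalDegree := by
  rw [lineRoots_eq, Multiset.toFinset_card_of_nodup (hfac.nodup_roots_lineHom hadm j s),
    ← (IsAlgClosed.splits _).natDegree_eq_card_roots, hfac.natDegree_lineHom]

theorem lineRoots_disjoint (j : Fin n) {s s' : Fin k} (hs : s ≠ s') :
    Disjoint (lineRoots R j s) (lineRoots R j s') := by
  have h0 : lineHom j (∏ s, R s) ≠ 0 := by
    rw [map_prod, Finset.prod_ne_zero_iff]
    exact fun s _ => hfac.lineHom_ne_zero j s
  have h1 : R s * R s' ∣ ∏ s, R s := by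
    rw [← Finset.prod_pair hs]
    exact Finset.prod_dvd_prod_of_subset _ _ _ (Finset.subset_univ _)
  have h2 := map_dvd (lineHom j) h1
  rw [map_mul] at h2
  have h3 := Multiset.nodup_of_le (roots.le_of_dvd h0 h2) (hfac.nodup_roots hadm j)
  rw [roots_mul (mul_ne_zero (hfac.lineHom_ne_zero j s) (hfac.lineHom_ne_zero j s')),
    Multiset.nodup_add] at h3
  rw [lineRoots_eq, lineRoots_eq, Multiset.disjoint_toFinset]
  exact h3.2.2

/-- Simplicity of the roots of each restricted `R s` is what allows the finite set `lineRoots` to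
replace the root multiset. -/
theorem charpoly_eq (j : Fin n) (S : Finset (Fin k)) :
    (A j).charpoly = qPoly R m S j * qPoly R m Sᶜ j := by
  rw [qPoly, qPoly, Finset.prod_mul_prod_compl]
  refine eq_of_monic_of_associated (A j).charpoly_monic ?_ ?_
  · exact monic_prod_of_monic _ _ fun s _ => monic_prod_of_monic _ _ fun l _ =>
      (monic_X_sub_C l).pow _
  · refine (hfac.associated_charpoly j).trans (Associated.prod _ _ _ fun s _ => ?_)
    rw [Finset.prod_pow]
    refine Associated.pow_pow ?_
    conv_lhs => rw [(IsAlgClosed.splits (lineHom j (R s))).eq_prod_roots]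
    rw [lineRoots_eq, Finset.prod, Multiset.toFinset_val,
      (hfac.nodup_roots_lineHom hadm j s).dedup]
    exact associated_unit_mul_left _ _ (isUnit_C.2 (isUnit_iff_ne_zero.2
      (leadingCoeff_ne_zero.2 (hfac.lineHom_ne_zero j s))))

theorem natDegree_qPoly (j : Fin n) (S : Finset (Fin k)) :
    (qPoly R m S j).natDegree = dimS R m S := by
  rw [qPoly, natDegree_prod_of_monic, dimS]
  · refine Finset.sum_congr rfl fun s _ => ?_
    rw [natDegree_prod_of_monic _ _ fun l _ => (monic_X_sub_C l).pow _]
    simp [hfac.card_lineRoots hadm]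
  · exact fun s _ => monic_prod_of_monic _ _ fun l _ => (monic_X_sub_C l).pow _

omit hadm in
theorem eval_qPoly_eq_zero {j : Fin n} {S : Finset (Fin k)} {z : ℂ} :
    (qPoly R m S j).eval z = 0 ↔ ∃ s ∈ S, z ∈ lineRoots R j s := by
  simp only [qPoly, eval_prod, Finset.prod_eq_zero_iff, eval_pow, eval_sub, eval_X, eval_C]
  refine exists_congr fun s => and_congr_right fun _ => ⟨?_, fun h => ⟨z, h, ?_⟩⟩
  · rintro ⟨l, hl, h⟩
    rw [sub_eq_zero.1 (eq_zero_of_pow_eq_zero h)]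
    exact hl
  · rw [sub_self, zero_pow (hfac.mult_pos s).ne']

theorem eval_qPoly_ne_zero {j : Fin n} {S : Finset (Fin k)} {z : ℂ} {s : Fin k} (hs : s ∉ S)
    (hz : z ∈ lineRoots R j s) : (qPoly R m S j).eval z ≠ 0 := by
  rw [Ne, hfac.eval_qPoly_eq_zero]
  rintro ⟨s', hs', hz'⟩
  refine Finset.disjoint_left.1 (hfac.lineRoots_disjoint hadm j (s := s) (s' := s') ?_) hz hz'
  rintro rfl
  exact hs hs'

theorem alpha_ne_zero (j : Fin n) (S : Finset (Fin k)) : alpha R m S j ≠ 0 := by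
  rw [alpha, Finset.prod_ne_zero_iff]
  intro s hs
  refine mul_ne_zero (pow_ne_zero _ (neg_ne_zero.2 one_ne_zero)) (Finset.prod_ne_zero_iff.2 ?_)
  exact fun l hl => pow_ne_zero _ (hfac.eval_qPoly_ne_zero hadm (Finset.mem_compl.1 hs) hl)

/-- Modulo `q = qPoly R m S j` each factor `q - q(l)` becomes `-q(l)`, and the product of these is
`alpha`, the sign coming from `l_s` being the number of roots. Divisibility by the complementary
factor holds because `X - l` divides `q - q(l)`. -/
theorem exists_projP_eq_aeval (j : Fin n) (S : Finset (Fin k)) :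
    ∃ p : ℂ[X], projP A R m S j = aeval (A j) p ∧ qPoly R m S j ∣ 1 - p ∧ qPoly R m Sᶜ j ∣ p := by
  refine ⟨C (alpha R m S j)⁻¹ * ∏ s ∈ Sᶜ, ∏ l ∈ lineRoots R j s,
      (qPoly R m S j - C ((qPoly R m S j).eval l)) ^ m s, ?_, ?_, ?_⟩
  · rw [projP, map_mul, aeval_C, Algebra.smul_def]
  · rw [← Ideal.mem_span_singleton, ← Ideal.Quotient.mk_eq_mk_iff_sub_mem]
    have h0 : Ideal.Quotient.mk (Ideal.span {qPoly R m S j}) (qPoly R m S j) = 0 :=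
      Ideal.Quotient.eq_zero_iff_mem.2 (Ideal.mem_span_singleton_self _)
    simp only [map_mul, map_prod, map_pow, map_sub, h0, zero_sub]
    simp only [← map_neg, ← map_pow, ← map_prod, ← map_mul]
    have h1 : ∏ s ∈ Sᶜ, ∏ l ∈ lineRoots R j s, (-(qPoly R m S j).eval l) ^ m s =
        alpha R m S j := by
      refine Finset.prod_congr rfl fun s _ => ?_
      rw [Finset.prod_pow, Finset.prod_neg, hfac.card_lineRoots hadm, mul_pow, pow_mul,
        Finset.prod_pow]
    rw [h1, inv_mul_cancel₀ (hfac.alpha_ne_zero hadm j S), map_one, map_one, map_one]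
  · refine Dvd.dvd.mul_left ?_ _
    exact Finset.prod_dvd_prod_of_dvd _ _ fun s _ => Finset.prod_dvd_prod_of_dvd _ _ fun l _ =>
      pow_dvd_pow_of_dvd (X_sub_C_dvd_sub_C_eval) _

theorem projP_mul_self (j : Fin n) (S : Finset (Fin k)) :
    projP A R m S j * projP A R m S j = projP A R m S j := by
  obtain ⟨p, hp, hq, hg⟩ := hfac.exists_projP_eq_aeval hadm j S
  rw [hp]
  exact riesz_mul_self (hfac.charpoly_eq hadm j S) hq hg

theorem trace_projP (j : Fin n) (S : Finset (Fin k)) :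
    (projP A R m S j).trace = dimS R m S := by
  obtain ⟨p, hp, hq, hg⟩ := hfac.exists_projP_eq_aeval hadm j S
  rw [hp, riesz_trace (hfac.charpoly_eq hadm j S) hq hg, hfac.natDegree_qPoly hadm]

theorem aeval_qPoly_mul_projP (j : Fin n) (S : Finset (Fin k)) :
    aeval (A j) (qPoly R m S j) * projP A R m S j = 0 := by
  obtain ⟨p, hp, hq, hg⟩ := hfac.exists_projP_eq_aeval hadm j S
  rw [hp]
  exact aeval_mul_aeval_eq_zero (hfac.charpoly_eq hadm j S) hg

theorem projP_mul_eq (j : Fin n) (S : Finset (Fin k)) {B : Matrix (Fin N) (Fin N) ℂ}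
    (hB : aeval (A j) (qPoly R m S j) * B = 0) : projP A R m S j * B = B := by
  obtain ⟨p, hp, hq, hg⟩ := hfac.exists_projP_eq_aeval hadm j S
  rw [hp]
  exact riesz_mul_eq hq hB

theorem aeval_mul_projP (j : Fin n) (S : Finset (Fin k)) (r : ℂ[X]) :
    aeval (A j) r * projP A R m S j = projP A R m S j * aeval (A j) r := by
  obtain ⟨p, hp, -⟩ := hfac.exists_projP_eq_aeval hadm j S
  rw [hp, ← map_mul, ← map_mul, mul_comm]

end IsFactorization

theorem capQ_eq (j : Fin n) (S : Finset (Fin k)) :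
    capQ A R m S j = capProj (projP A R m S j) := rfl

theorem capQ_isHermitian (j : Fin n) (S : Finset (Fin k)) : (capQ A R m S j).IsHermitian :=
  capProj_isHermitian _

theorem capQ_mul_self (j : Fin n) (S : Finset (Fin k)) :
    capQ A R m S j * capQ A R m S j = capQ A R m S j :=
  capProj_mul_self _

theorem trace_capQ (hfac : IsFactorization A R m) (hadm : Admissible A R)
    (j : Fin n) (S : Finset (Fin k)) : (capQ A R m S j).trace = dimS R m S := by
  rw [capQ_eq, trace_capProj (hfac.projP_mul_self hadm j S), hfac.trace_projP hadm]

end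

/-! ### Joint spectra and zero loci in homogeneous coordinates. -/

section Spectrum
variable {κ : Type*} [Fintype κ]

theorem pencil_smul {𝒜 : Type*} [Ring 𝒜] [Algebra ℂ 𝒜] (A : κ → 𝒜) (c : ℂ) (x : Option κ → ℂ) :
    pencil A (c • x) = c • pencil A x := by
  simp [pencil, smul_sub, Finset.smul_sum, mul_smul]

theorem mk_mem_jointSpectrum {𝒜 : Type*} [Ring 𝒜] [Algebra ℂ 𝒜] (A : κ → 𝒜)
    {x : Option κ → ℂ} (hx : x ≠ 0) :
    Projectivization.mk ℂ x hx ∈ jointSpectrum A ↔ ¬ IsUnit (pencil A x) := by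
  obtain ⟨a, ha⟩ := Projectivization.exists_smul_eq_mk_rep ℂ x hx
  have h : pencil A (Projectivization.mk ℂ x hx).rep = a • pencil A x := by
    rw [← ha]; exact pencil_smul A a x
  rw [jointSpectrum, Set.mem_ofPred_eq, h, isUnit_smul_iff]

omit [Fintype κ] in
theorem mk_mem_zeroLocus {F : MvPolynomial (Option κ) ℂ} {d : ℕ} (hF : F.IsHomogeneous d)
    {x : Option κ → ℂ} (hx : x ≠ 0) :
    Projectivization.mk ℂ x hx ∈ zeroLocus F ↔ MvPolynomial.eval x F = 0 := by
  obtain ⟨a, ha⟩ := Projectivization.exists_smul_eq_mk_rep ℂ x hx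
  have h : MvPolynomial.eval (Projectivization.mk ℂ x hx).rep F =
      (a : ℂ) ^ d * MvPolynomial.eval x F := by
    rw [← ha]; exact eval_smul_of_isHomogeneous hF a x
  rw [zeroLocus, Set.mem_ofPred_eq, h, mul_eq_zero, or_iff_right (pow_ne_zero _ a.ne_zero)]

theorem jointSpectrum_eq_zeroLocus {N : ℕ} (A : κ → Matrix (Fin N) (Fin N) ℂ) :
    jointSpectrum A = zeroLocus (detPencil A) := by
  ext p
  rw [jointSpectrum, zeroLocus, Set.mem_ofPred_eq, Set.mem_ofPred_eq, eval_detPencil,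
    Matrix.isUnit_iff_isUnit_det, isUnit_iff_ne_zero, not_not]

end Spectrum

/-! ### Condition (b) and coinciding projections. -/

section Projections
variable {n N M : ℕ} {Q : Fin n → Matrix (Fin N) (Fin N) ℂ}

theorem eval_planePoly (M M' : ℕ) (x : Option (Fin n) → ℂ) :
    MvPolynomial.eval x (planePoly n M M') = (∑ j, x (some j) - x none) ^ M * x none ^ M' := by
  simp [planePoly]

theorem isHomogeneous_planePoly (M M' : ℕ) : (planePoly n M M').IsHomogeneous (M + M') := by
  have h1 : (∑ j : Fin n, MvPolynomial.X (some j) - MvPolynomial.X none :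
      MvPolynomial (Option (Fin n)) ℂ).IsHomogeneous 1 :=
    (MvPolynomial.IsHomogeneous.sum _ _ _ fun j _ => MvPolynomial.isHomogeneous_X _ _).sub
      (MvPolynomial.isHomogeneous_X _ _)
  have h2 := (h1.pow M).mul ((MvPolynomial.isHomogeneous_X ℂ (none : Option (Fin n))).pow M')
  rwa [one_mul, one_mul] at h2

theorem detPencil_of_forall_eq (hQ : ∀ j, Q j * Q j = Q j) (ht : ∀ j, (Q j).trace = M)
    (hM : M ≤ N) (h : ∀ i j, Q i = Q j) :
    detPencil Q = (-1) ^ (N - M) * planePoly n M (N - M) := by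
  refine MvPolynomial.funext fun x => ?_
  rw [eval_detPencil, map_mul, eval_planePoly, map_pow, map_neg, map_one]
  -- For `n = 0` no projection is available and the pencil is a scalar; otherwise it is the pencil
  -- of one idempotent.
  rcases isEmpty_or_nonempty (Fin n) with hn | ⟨⟨j⟩⟩
  · have h1 : pencil Q x = -(x none • (1 : Matrix (Fin N) (Fin N) ℂ)) := by simp [pencil]
    obtain ⟨d, rfl⟩ := Nat.exists_eq_add_of_le hM
    rw [h1, Matrix.det_neg, Matrix.det_smul, Matrix.det_one, Fintype.card_fin]
    simp only [Finset.univ_eq_empty, Finset.sum_empty, zero_sub, add_tsub_cancel_left]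
    rw [neg_pow (x none)]
    ring
  · have h1 : pencil Q x = (∑ j, x (some j)) • Q j - x none • (1 : Matrix (Fin N) (Fin N) ℂ) := by
      rw [pencil, Finset.sum_smul]
      congr 1
      exact Finset.sum_congr rfl fun i _ => by rw [h i j]
    rw [h1, (det_idempotent_pencil (hQ j) (ht j) _ _).2, Fintype.card_fin, neg_pow (x none)]
    ring

theorem jointSpectrum_of_detPencil {M' : ℕ} (h : detPencil Q = (-1) ^ M' * planePoly n M M') :
    jointSpectrum Q = zeroLocus (planePoly n M M') := by
  rw [jointSpectrum_eq_zeroLocus, h]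
  ext p
  rw [zeroLocus, zeroLocus, Set.mem_ofPred_eq, Set.mem_ofPred_eq, map_mul, mul_eq_zero,
    or_iff_right]
  simp

/-- Orthogonal projections of equal trace coincide as soon as their sum has no eigenvalues besides
`0` and the number of the projections. -/
theorem forall_eq_of_eigenvalues (hH : ∀ j, (Q j).IsHermitian) (hQ : ∀ j, Q j * Q j = Q j)
    (ht : ∀ j, (Q j).trace = M)
    (h : ∀ z : ℂ, z ≠ 0 → z ≠ n → IsUnit (∑ j, Q j - z • (1 : Matrix (Fin N) (Fin N) ℂ))) :
    ∀ i j, Q i = Q j := by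
  set T := ∑ j, Q j with hT
  have hTH : T.IsHermitian := by
    rw [Matrix.IsHermitian, hT, Matrix.conjTranspose_sum]
    exact Finset.sum_congr rfl fun j _ => hH j
  have hT2 : T * T = (n : ℂ) • T := by
    have h1 := aeval_isHermitian_eq_zero hTH (X * X - C (n : ℂ) * X) (fun i => by
      by_contra h0
      refine not_isUnit_sub_eigenvalue hTH i (h _ ?_ ?_)
      · intro h1; simp [h1] at h0
      · intro h1; simp [h1] at h0)
    rw [map_sub, map_mul, map_mul, aeval_X, aeval_C, Algebra.algebraMap_eq_smul_one, smul_mul_assoc,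
      one_mul, sub_eq_zero] at h1
    exact h1
  -- The sum is `2n²M - 2 tr T²`, and `tr T² = n tr T = n²M`.
  have hsum : ∑ i, ∑ j, ((Q i - Q j)ᴴ * (Q i - Q j)).trace = 0 := by
    have h1 : ∀ i j, ((Q i - Q j)ᴴ * (Q i - Q j)).trace =
        2 * (M : ℂ) - 2 * (Q i * Q j).trace := by
      intro i j
      rw [Matrix.conjTranspose_sub, (hH i).eq, (hH j).eq, mul_sub, sub_mul, sub_mul, hQ, hQ,
        Matrix.trace_sub, Matrix.trace_sub, Matrix.trace_sub, ht, ht,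
        Matrix.trace_mul_comm (Q j) (Q i)]
      ring
    have h2 : ∑ i, ∑ j, (Q i * Q j).trace = (T * T).trace := by
      rw [hT, Finset.sum_mul, Matrix.trace_sum]
      refine Finset.sum_congr rfl fun i _ => ?_
      rw [Finset.mul_sum, Matrix.trace_sum]
    have h3 : T.trace = n * M := by
      rw [hT, Matrix.trace_sum]
      simp [ht]
    simp only [h1, Finset.sum_sub_distrib, ← Finset.mul_sum]
    rw [h2, hT2, Matrix.trace_smul, h3]
    simp
  have hre : ∀ i j, 0 ≤ (((Q i - Q j)ᴴ * (Q i - Q j)).trace).re := by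
    intro i j
    have := (Matrix.posSemidef_conjTranspose_mul_self (Q i - Q j)).trace_nonneg
    exact (Complex.le_def.1 this).1
  intro i j
  have h0 := congrArg Complex.re hsum
  simp only [Complex.re_sum, Complex.zero_re] at h0
  rw [Finset.sum_eq_zero_iff_of_nonneg fun i _ => Finset.sum_nonneg fun j _ => hre i j] at h0
  have h1 := h0 i (Finset.mem_univ i)
  rw [Finset.sum_eq_zero_iff_of_nonneg fun j _ => hre i j] at h1
  have h2 := h1 j (Finset.mem_univ j)
  have h3 : ((Q i - Q j)ᴴ * (Q i - Q j)).trace = 0 := by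
    have h4 := (Matrix.posSemidef_conjTranspose_mul_self (Q i - Q j)).trace_nonneg
    exact Complex.ext h2 (Complex.le_def.1 h4).2.symm
  rw [Matrix.trace_conjTranspose_mul_self_eq_zero_iff, sub_eq_zero] at h3
  exact h3

theorem forall_eq_of_jointSpectrum {M' : ℕ} (hH : ∀ j, (Q j).IsHermitian)
    (hQ : ∀ j, Q j * Q j = Q j) (ht : ∀ j, (Q j).trace = M)
    (h : jointSpectrum Q = zeroLocus (planePoly n M M')) : ∀ i j, Q i = Q j := by
  refine forall_eq_of_eigenvalues hH hQ ht fun z hz hn => ?_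
  by_contra hu
  -- The test point is `[1 : ⋯ : 1 : z]`; `z ≠ 0` keeps it legitimate even when `n = 0`.
  have hx : (fun o : Option (Fin n) => o.elim z fun _ => 1) ≠ 0 := by
    intro h0
    exact hz (congrFun h0 none)
  have h1 : Projectivization.mk ℂ _ hx ∈ jointSpectrum Q := by
    rw [mk_mem_jointSpectrum]
    simpa [pencil] using hu
  rw [h, mk_mem_zeroLocus (isHomogeneous_planePoly M M'), eval_planePoly] at h1
  simp only [Option.elim_some, Option.elim_none, Finset.sum_const, Finset.card_univ,
    Fintype.card_fin, nsmul_eq_mul, mul_one] at h1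
  exact mul_ne_zero (pow_ne_zero _ (sub_ne_zero.2 hn.symm)) (pow_ne_zero _ hz) h1

end Projections

/-! ### Simple spectra and first-order perturbation. -/

section Charpoly
variable {N : ℕ}

/-- Simplicity for `X` alone is enough: its `N` distinct roots already exhaust the `N` roots of `Y`.
-/
theorem charpoly_eq_of_spectrum_eq {X Y : Matrix (Fin N) (Fin N) ℂ}
    (h : ∀ z : ℂ, IsUnit (X - z • (1 : Matrix (Fin N) (Fin N) ℂ)) ↔
      IsUnit (Y - z • (1 : Matrix (Fin N) (Fin N) ℂ)))
    (hX : X.charpoly.roots.Nodup) : X.charpoly = Y.charpoly := by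
  have key : ∀ (B : Matrix (Fin N) (Fin N) ℂ) (z : ℂ), z ∈ B.charpoly.roots ↔
      ¬ IsUnit (B - z • (1 : Matrix (Fin N) (Fin N) ℂ)) := by
    intro B z
    rw [mem_roots B.charpoly_monic.ne_zero, ← Matrix.mem_spectrum_iff_isRoot_charpoly,
      spectrum.mem_iff, Algebra.algebraMap_eq_smul_one, ← IsUnit.neg_iff, neg_sub]
  have hle : X.charpoly.roots ≤ Y.charpoly.roots := by
    rw [Multiset.le_iff_subset hX]
    intro z hz
    rw [key] at hz ⊢
    rwa [← h]
  have heq := Multiset.eq_of_le_of_card_le hle (by rw [card_roots_charpoly, card_roots_charpoly])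
  rw [charpoly_eq_prod_roots X, heq, ← charpoly_eq_prod_roots Y]

/-- If the characteristic polynomial is small at each of `N` well separated points, then the
eigenvalues are simple. -/
theorem nodup_roots_of_norm_eval_lt {X : Matrix (Fin N) (Fin N) ℂ} {lam : Fin N → ℂ} {δ : ℝ}
    (hδ : 0 < δ) (hsep : ∀ i j, i ≠ j → 2 * δ ≤ ‖lam i - lam j‖)
    (hX : ∀ i, ‖X.charpoly.eval (lam i)‖ < δ ^ N) : X.charpoly.roots.Nodup := by
  have h1 : ∀ i, ∃ ρ ∈ X.charpoly.roots, ‖lam i - ρ‖ < δ := by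
    intro i
    by_contra! h
    have h2 : ∀ s : Multiset ℂ, (∀ ρ ∈ s, δ ≤ ‖lam i - ρ‖) →
        δ ^ Multiset.card s ≤ ‖((s.map fun l => Polynomial.X - C l).prod : ℂ[X]).eval (lam i)‖ := by
      intro s
      induction s using Multiset.induction_on with
      | empty => simp
      | cons c s ih =>
        intro hs
        rw [Multiset.card_cons, pow_succ', Multiset.map_cons, Multiset.prod_cons, eval_mul, norm_mul]
        have h3 := hs c (Multiset.mem_cons_self _ _)
        have h4 := ih fun ρ hρ => hs ρ (Multiset.mem_cons_of_mem hρ)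
        simp only [eval_sub, eval_X, eval_C]
        gcongr
    have h3 := h2 _ h
    rw [← charpoly_eq_prod_roots, card_roots_charpoly, Fintype.card_fin] at h3
    exact absurd (hX i) (not_lt.2 h3)
  choose ρ hρ hρ' using h1
  -- The discs of radius `δ` about the points `lam i` are disjoint, so they contain `N` different
  -- roots.
  have hinj : Function.Injective ρ := by
    intro i j hij
    by_contra hne
    have h2 := hsep i j hne
    have h3 : ‖lam i - lam j‖ ≤ ‖lam i - ρ i‖ + ‖lam j - ρ j‖ := by
      have : lam i - lam j = (lam i - ρ i) - (lam j - ρ j) := by rw [hij]; ring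
      rw [this]
      exact norm_sub_le _ _
    linarith [hρ' i, hρ' j]
  rw [← Multiset.toFinset_card_eq_card_iff_nodup]
  refine le_antisymm (Multiset.toFinset_card_le _) ?_
  rw [card_roots_charpoly, Fintype.card_fin]
  have h4 : Finset.univ.image ρ ⊆ X.charpoly.roots.toFinset := by
    intro z hz
    obtain ⟨i, -, rfl⟩ := Finset.mem_image.1 hz
    exact Multiset.mem_toFinset.2 (hρ i)
  have h5 := Finset.card_le_card h4
  rwa [Finset.card_image_of_injective _ hinj, Finset.card_univ, Fintype.card_fin] at h5

theorem eventually_nodup_roots {lam : Fin N → ℂ} (hlam : Function.Injective lam)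
    (U V : Matrix (Fin N) (Fin N) ℂ) :
    ∀ᶠ p : ℂ × ℂ in nhds 0,
      (Matrix.diagonal lam + p.1 • U + p.2 • V).charpoly.roots.Nodup := by
  obtain ⟨δ, hδ, hsep⟩ : ∃ δ : ℝ, 0 < δ ∧ ∀ i j, i ≠ j → 2 * δ ≤ ‖lam i - lam j‖ := by
    have h : ∀ᶠ δ : ℝ in nhdsWithin 0 (Set.Ioi 0),
        0 < δ ∧ ∀ i j, i ≠ j → 2 * δ ≤ ‖lam i - lam j‖ := by
      refine (eventually_mem_nhdsWithin).and (Filter.eventually_all.2 fun i =>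
        Filter.eventually_all.2 fun j => ?_)
      by_cases hij : i = j
      · simp [hij]
      · have h0 : 0 < ‖lam i - lam j‖ := norm_pos_iff.2 (sub_ne_zero.2 (hlam.ne hij))
        have h1 : ∀ᶠ δ : ℝ in nhds 0, δ < ‖lam i - lam j‖ / 2 :=
          Filter.Eventually.mono (Iio_mem_nhds (half_pos h0)) fun _ h => h
        filter_upwards [nhdsWithin_le_nhds h1] with δ hδ _
        linarith
    exact h.exists
  have hev : ∀ i, ∀ᶠ p : ℂ × ℂ in nhds 0,
      ‖(Matrix.diagonal lam + p.1 • U + p.2 • V).charpoly.eval (lam i)‖ < δ ^ N := by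
    intro i
    have hc : Continuous fun p : ℂ × ℂ =>
        ‖(Matrix.diagonal lam + p.1 • U + p.2 • V).charpoly.eval (lam i)‖ := by
      simp only [Matrix.eval_charpoly]
      fun_prop
    have h0 : ‖(Matrix.diagonal lam + (0 : ℂ × ℂ).1 • U +
        (0 : ℂ × ℂ).2 • V).charpoly.eval (lam i)‖ < δ ^ N := by
      simp only [Prod.fst_zero, Prod.snd_zero, zero_smul, add_zero, Matrix.eval_charpoly,
        Matrix.scalar_apply, Matrix.diagonal_sub, Matrix.det_diagonal]
      rw [Finset.prod_eq_zero (Finset.mem_univ i) (sub_self _), norm_zero]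
      positivity
    exact hc.continuousAt.eventually (Iio_mem_nhds h0)
  filter_upwards [Filter.eventually_all.2 hev] with p hp
  exact nodup_roots_of_norm_eval_lt hδ hsep hp

/-- The derivative of `y ↦ det (X + y Q)` at `0`. -/
theorem trace_eq_of_det_eq {X Q Q' : Matrix (Fin N) (Fin N) ℂ} (hX : IsUnit X.det)
    (h : ∀ᶠ y : ℂ in nhds 0, (X + y • Q).det = (X + y • Q').det) :
    (X⁻¹ * Q).trace = (X⁻¹ * Q').trace := by
  have key : ∀ B : Matrix (Fin N) (Fin N) ℂ, ∀ y : ℂ, X.det *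
      ((1 + (Polynomial.X : ℂ[X]) • (X⁻¹ * B).map C).det).eval y = (X + y • B).det := by
    intro B y
    have h1 : ((1 + (Polynomial.X : ℂ[X]) • (X⁻¹ * B).map C).det).eval y =
        (1 + y • (X⁻¹ * B)).det := by
      rw [← coe_evalRingHom, RingHom.map_det]
      congr 1
      ext a b
      by_cases hab : a = b <;> simp [hab, mul_comm y, -Matrix.map_mul]
    rw [h1, ← Matrix.det_mul, mul_add, mul_one, mul_smul_comm, Matrix.mul_nonsing_inv_cancel_left _ _ hX]
  -- Both sides are polynomials in `y` that agree on a neighbourhood of 0, an infinite set.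
  have heq : (1 + (Polynomial.X : ℂ[X]) • (X⁻¹ * Q).map C).det =
      (1 + (Polynomial.X : ℂ[X]) • (X⁻¹ * Q').map C).det := by
    refine Polynomial.eq_of_infinite_eval_eq _ _ (Set.Infinite.mono ?_ (infinite_of_mem_nhds 0 h))
    intro y hy
    have hy' : (X + y • Q).det = (X + y • Q').det := hy
    rw [← key, ← key] at hy'
    exact mul_left_cancel₀ hX.ne_zero hy'
  rw [← Matrix.derivative_det_one_add_X_smul, ← Matrix.derivative_det_one_add_X_smul, heq]

end Charpoly

/-! ### Resolvents of a diagonal matrix plus a multiple of the shift. -/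

section Shift
variable {N : ℕ}

/-- The only path from `b` to `c` is `b, b + 1, …, c`; each step picks up the weight of its
endpoint, so `b` itself is not counted. -/
theorem mul_shift_pow_apply (g : Fin N → ℂ) (a : ℕ) (b c : Fin N) :
    ((Matrix.diagonal g * shift N) ^ a) c b =
      if (c : ℕ) = b + a then ∏ l ∈ Finset.Ioc b c, g l else 0 := by
  induction a generalizing b with
  | zero =>
    rw [pow_zero, Matrix.one_apply, add_zero]
    by_cases h : c = b
    · simp [h]
    · rw [if_neg h, if_neg fun h' => h (Fin.ext h')]
  | succ a ih =>
    rw [pow_succ, Matrix.mul_apply]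
    simp only [ih]
    simp only [Matrix.diagonal_mul, shift, Matrix.of_apply]
    by_cases hb : (b : ℕ) + 1 < N
    · rw [Finset.sum_eq_single (⟨b + 1, hb⟩ : Fin N)]
      · simp only [if_true, mul_one, ite_mul, zero_mul]
        refine if_ctx_congr (by omega) (fun h => ?_) fun _ => rfl
        have h1 : Finset.Ioc b c = insert ⟨b + 1, hb⟩ (Finset.Ioc ⟨b + 1, hb⟩ c) := by
          ext l
          simp only [Finset.mem_Ioc, Finset.mem_insert, Fin.lt_def, Fin.le_def, Fin.ext_iff]
          omega
        rw [h1, Finset.prod_insert (by simp), mul_comm]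
      · intro e _ he
        rw [if_neg (c := (e : ℕ) = b + 1) fun h => he (Fin.ext h), mul_zero, mul_zero]
      · simp
    · rw [if_neg (by omega)]
      refine Finset.sum_eq_zero fun e _ => ?_
      rw [if_neg (c := (e : ℕ) = b + 1) (by omega), mul_zero, mul_zero]

theorem mul_shift_pow_mul_apply (g : Fin N → ℂ) (a : ℕ) (b c : Fin N) :
    ((Matrix.diagonal g * shift N) ^ a * Matrix.diagonal g) c b =
      if (c : ℕ) = b + a then ∏ l ∈ Finset.Icc b c, g l else 0 := by
  rw [Matrix.mul_diagonal, mul_shift_pow_apply, ite_mul, zero_mul]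
  refine if_ctx_congr Iff.rfl (fun h => ?_) fun _ => rfl
  have hbc : b ≤ c := by rw [Fin.le_def]; omega
  rw [← Finset.Ioc_insert_left hbc, Finset.prod_insert (by simp), mul_comm]

theorem mul_shift_pow_eq_zero (g : Fin N → ℂ) :
    (Matrix.diagonal g * shift N) ^ N = 0 := by
  ext c b
  rw [mul_shift_pow_apply, if_neg (by omega), Matrix.zero_apply]

theorem det_diagonal_add_shift (d : Fin N → ℂ) (x : ℂ) :
    (Matrix.diagonal d + x • shift N).det = ∏ i, d i := by
  rw [Matrix.det_of_isLowerTriangular]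
  · simp [shift]
  · intro i j hij
    have hij' : i < j := hij
    simp only [Matrix.add_apply, Matrix.smul_apply, shift, Matrix.of_apply]
    rw [Matrix.diagonal_apply_ne _ hij'.ne, if_neg (by rw [Fin.lt_def] at hij'; omega)]
    simp

/-- A Neumann series, which is finite because the weighted shift is nilpotent. -/
theorem inv_diagonal_add_shift (d : Fin N → ℂ) (hd : ∀ i, d i ≠ 0) (x : ℂ) :
    (Matrix.diagonal d + x • shift N)⁻¹ = ∑ a ∈ Finset.range N,
      (-x) ^ a • ((Matrix.diagonal (fun i => (d i)⁻¹) * shift N) ^ a *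
        Matrix.diagonal fun i => (d i)⁻¹) := by
  set G := Matrix.diagonal fun i => (d i)⁻¹ with hG
  have hGd : G * Matrix.diagonal d = 1 := by
    rw [hG, Matrix.diagonal_mul_diagonal, ← Matrix.diagonal_one]
    congr 1
    ext i
    exact inv_mul_cancel₀ (hd i)
  refine Matrix.inv_eq_left_inv ?_
  have h1 : G * (Matrix.diagonal d + x • shift N) = 1 - (-x) • (G * shift N) := by
    rw [mul_add, hGd, mul_smul_comm, neg_smul, sub_neg_eq_add]
  have h2 : ∀ a, (-x) ^ a • ((G * shift N) ^ a * G) = ((-x) • (G * shift N)) ^ a * G := by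
    intro a
    rw [_root_.smul_pow, smul_mul_assoc]
  rw [Finset.sum_congr rfl fun a _ => h2 a, ← Finset.sum_mul, mul_assoc, h1, geom_sum_mul_neg,
    _root_.smul_pow, hG, mul_shift_pow_eq_zero, smul_zero, sub_zero]

/-- The resolvents of `diag lam + x T` separate the upper triangular parts of matrices. -/
theorem eq_zero_of_trace_resolvent {lam : Fin N → ℂ} (hlam : Function.Injective lam)
    {D : Matrix (Fin N) (Fin N) ℂ}
    (h : ∀ᶠ x : ℂ in nhds 0, ∀ z, z ∉ Set.range lam →
      ((Matrix.diagonal (fun i => lam i - z) + x • shift N)⁻¹ * D).trace = 0)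
    (b c : Fin N) (hbc : b ≤ c) : D b c = 0 := by
  have h1 : ∀ z, z ∉ Set.range lam → ∀ a < N,
      ((Matrix.diagonal (fun i => (lam i - z)⁻¹) * shift N) ^ a *
        Matrix.diagonal (fun i => (lam i - z)⁻¹) * D).trace = 0 := by
    intro z hz a ha
    set w : ℕ → ℂ := fun a => ((Matrix.diagonal (fun i => (lam i - z)⁻¹) * shift N) ^ a *
        Matrix.diagonal (fun i => (lam i - z)⁻¹) * D).trace with hw
    have hd : ∀ i, lam i - z ≠ 0 := fun i h0 => hz ⟨i, sub_eq_zero.1 h0⟩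
    -- The trace is a polynomial in `x`, so its coefficients vanish one by one; the power `x ^ a`
    -- isolates the `a`-th superdiagonal of `D`.
    have hp : ∑ a ∈ Finset.range N, monomial a ((-1) ^ a * w a) = 0 := by
      refine Polynomial.eq_zero_of_infinite_isRoot _
        (Set.Infinite.mono ?_ (infinite_of_mem_nhds 0 h))
      intro x hx
      have hx' := hx z hz
      rw [inv_diagonal_add_shift _ hd, Finset.sum_mul, Matrix.trace_sum] at hx'
      change eval x _ = 0
      rw [eval_finsetSum, ← hx']
      refine Finset.sum_congr rfl fun a _ => ?_
      rw [eval_monomial, smul_mul_assoc, Matrix.trace_smul, neg_pow, smul_eq_mul, hw]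
      ring
    have hc := congrArg (fun p : ℂ[X] => p.coeff a) hp
    simp only [finsetSum_coeff, coeff_monomial, coeff_zero] at hc
    rw [Finset.sum_ite_eq' , if_pos (Finset.mem_range.2 ha)] at hc
    exact (mul_eq_zero.1 hc).resolve_left (pow_ne_zero _ (neg_ne_zero.2 one_ne_zero))
  -- Clearing denominators gives a polynomial in `z`, which vanishes off a finite set and hence also
  -- at the points `lam b`.
  have h2 : ∀ a < N, ∀ z, ∑ b : Fin N, ∑ c : Fin N, (if (c : ℕ) = b + a then
      D b c * ∏ l ∈ (Finset.Icc b c)ᶜ, (lam l - z) else 0) = 0 := by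
    intro a ha
    set F : ℂ[X] := ∑ b : Fin N, ∑ c : Fin N, (if (c : ℕ) = b + a then
      C (D b c) * ∏ l ∈ (Finset.Icc b c)ᶜ, (C (lam l) - X) else 0) with hF
    have hFe : ∀ z, F.eval z = ∑ b : Fin N, ∑ c : Fin N, (if (c : ℕ) = b + a then
        D b c * ∏ l ∈ (Finset.Icc b c)ᶜ, (lam l - z) else 0) := by
      intro z
      rw [hF, eval_finsetSum]
      refine Finset.sum_congr rfl fun b _ => ?_
      rw [eval_finsetSum]
      refine Finset.sum_congr rfl fun c _ => ?_
      split_ifs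
      · simp [eval_prod]
      · simp
    have hF0 : F = 0 := by
      refine Polynomial.eq_zero_of_infinite_isRoot _
        (Set.Infinite.mono ?_ (Set.finite_range lam).infinite_compl)
      intro z hz
      change F.eval z = 0
      have h3 := h1 z hz a ha
      have hd : ∀ i, lam i - z ≠ 0 := fun i h0 => hz ⟨i, sub_eq_zero.1 h0⟩
      refine (hFe z).trans (Eq.trans ?_
        ((congrArg ((∏ l, (lam l - z)) * ·) h3).trans (mul_zero _)))
      rw [Matrix.trace_mul_comm, Matrix.trace, Finset.mul_sum]
      refine Finset.sum_congr rfl fun b _ => ?_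
      rw [Matrix.diag_apply, Matrix.mul_apply, Finset.mul_sum]
      refine Finset.sum_congr rfl fun c _ => ?_
      rw [mul_shift_pow_mul_apply]
      split_ifs
      · rw [← Finset.prod_mul_prod_compl (Finset.Icc b c), Finset.prod_inv_distrib]
        have h4 : ∏ l ∈ Finset.Icc b c, (lam l - z) ≠ 0 :=
          Finset.prod_ne_zero_iff.2 fun l _ => hd l
        field_simp
      · simp
    intro z
    rw [← hFe, hF0, eval_zero]
  obtain ⟨a, ha⟩ := Nat.exists_eq_add_of_le (Fin.le_def.1 hbc)
  have haN : a < N := by omega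
  have key : ∀ i : ℕ, ∀ b c : Fin N, (b : ℕ) = i → (c : ℕ) = b + a → D b c = 0 := by
    intro i
    induction i using Nat.strong_induction_on with
    | _ i ih =>
      intro b c hb hc
      -- At `z = lam b` the terms starting after `b` contain the factor `lam b - z = 0`, and those
      -- starting before `b` vanish by induction. The coefficient of the remaining entry is nonzero
      -- since the `lam` are distinct.
      have h3 := h2 a haN (lam b)
      rw [Finset.sum_eq_single b, Finset.sum_eq_single c, if_pos hc] at h3
      · refine (mul_eq_zero.1 h3).resolve_right (Finset.prod_ne_zero_iff.2 fun l hl h0 => ?_)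
        have h4 : l = b := hlam (sub_eq_zero.1 h0)
        rw [Finset.mem_compl, Finset.mem_Icc, h4, Fin.le_def, Fin.le_def] at hl
        omega
      · intro c' _ hc'
        rw [if_neg fun h4 => hc' (Fin.ext (h4.trans hc.symm))]
      · simp
      · intro b' _ hb'
        refine Finset.sum_eq_zero fun c' _ => ?_
        split_ifs with hc'
        · by_cases hlt : (b' : ℕ) < b
          · rw [ih b' (by omega) b' c' rfl hc', zero_mul]
          · have h5 : (b' : ℕ) ≠ b := fun h6 => hb' (Fin.ext h6)
            rw [Finset.prod_eq_zero (i := b), mul_zero]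
            · rw [Finset.mem_compl, Finset.mem_Icc, Fin.le_def, Fin.le_def]
              omega
            · exact sub_self _
        · rfl
      · simp
  exact key b b c rfl ha

end Shift

/-! ### Condition (c) and coinciding projections. -/

section Permutation
variable {n N : ℕ} {lam : Fin N → ℂ} {Q : Fin n → Matrix (Fin N) (Fin N) ℂ}

theorem pencil_extTuple (x : Option (Fin 3 ⊕ Fin n) → ℂ) :
    pencil (extTuple lam Q) x = x (some (Sum.inl 0)) • Matrix.diagonal lam +
      x (some (Sum.inl 1)) • shift N + x (some (Sum.inl 2)) • (shift N)ᴴ +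
      ∑ j, x (some (Sum.inr j)) • Q j - x none • (1 : Matrix (Fin N) (Fin N) ℂ) := by
  simp [pencil, extTuple, Fin.sum_univ_three]

theorem mk_mem_image_permuteCoords {ι : Type*} (e : Equiv.Perm ι)
    (s : Set (Projectivization ℂ (ι → ℂ))) {x : ι → ℂ} (hx : x ≠ 0) (hx' : x ∘ e ≠ 0)
    (h : Projectivization.mk ℂ x hx ∈ s) :
    Projectivization.mk ℂ (x ∘ e) hx' ∈ permuteCoords e '' s :=
  ⟨_, h, rfl⟩

theorem permuteTail_image_of_forall_eq (h : ∀ i j, Q i = Q j) (τ : Equiv.Perm (Fin n)) :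
    permuteCoords (permuteTail τ) '' jointSpectrum (extTuple lam Q) =
      jointSpectrum (extTuple lam Q) := by
  have hp : ∀ (τ : Equiv.Perm (Fin n)) (x : Option (Fin 3 ⊕ Fin n) → ℂ),
      pencil (extTuple lam Q) (x ∘ permuteTail τ) = pencil (extTuple lam Q) x := by
    intro τ x
    rw [pencil_extTuple, pencil_extTuple]
    congr 2
    refine (Finset.sum_congr rfl fun j _ => ?_).trans
      (Equiv.sum_comp τ fun j => x (some (Sum.inr j)) • Q j)
    rw [h j (τ j)]
    rfl
  have hne : ∀ (τ : Equiv.Perm (Fin n)) {x : Option (Fin 3 ⊕ Fin n) → ℂ}, x ≠ 0 →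
      x ∘ permuteTail τ ≠ 0 := by
    intro τ x hx h0
    refine hx (funext fun o => ?_)
    have := congrFun h0 ((permuteTail τ).symm o)
    simpa using this
  refine Set.Subset.antisymm ?_ ?_
  · rintro _ ⟨p, hp', rfl⟩
    induction p using Projectivization.ind with
    | h x hx =>
    have h1 : permuteCoords (permuteTail τ) (Projectivization.mk ℂ x hx) =
      Projectivization.mk ℂ (x ∘ permuteTail τ) (hne τ hx) := rfl
    rw [h1, mk_mem_jointSpectrum, hp]
    rwa [mk_mem_jointSpectrum] at hp'
  · intro p hp'
    induction p using Projectivization.ind with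
    | h x hx =>
    have h2 : (permuteTail τ).symm = permuteTail (n := n) τ.symm := by
      ext o
      rcases o with _ | (l | l) <;> rfl
    have h3 : x ∘ (permuteTail τ).symm ≠ 0 := by
      rw [h2]; exact hne _ hx
    refine ⟨Projectivization.mk ℂ (x ∘ (permuteTail τ).symm) h3, ?_, ?_⟩
    · rw [mk_mem_jointSpectrum, h2, hp]
      rwa [mk_mem_jointSpectrum] at hp'
    · change Projectivization.mk ℂ ((x ∘ (permuteTail τ).symm) ∘ permuteTail τ) _ = _
      congr 1
      ext o
      simp

/-- The point with first coordinates `1, u, 0`, the coordinate `y` at the `i`-th member of the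
tail and last coordinate `z`. -/
def tailPoint (i : Fin n) (u y z : ℂ) : Option (Fin 3 ⊕ Fin n) → ℂ :=
  fun o => o.elim z (Sum.elim ![1, u, 0] fun l => if l = i then y else 0)

theorem tailPoint_ne_zero (i : Fin n) (u y z : ℂ) : tailPoint i u y z ≠ 0 := fun h =>
  one_ne_zero (congrFun h (some (Sum.inl 0)))

theorem tailPoint_comp_swap (i j : Fin n) (u y z : ℂ) :
    tailPoint i u y z ∘ permuteTail (Equiv.swap i j) = tailPoint j u y z := by
  ext o
  rcases o with _ | (l | l)
  · rfl
  · rfl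
  · have h : Equiv.swap i j l = i ↔ l = j := by
      rw [Equiv.swap_apply_eq_iff, Equiv.swap_apply_left]
    change (if Equiv.swap i j l = i then y else 0) = if l = j then y else 0
    simp only [h]

theorem pencil_tailPoint (i : Fin n) (u y z : ℂ) :
    pencil (extTuple lam Q) (tailPoint i u y z) =
      Matrix.diagonal lam + u • shift N + y • Q i - z • (1 : Matrix (Fin N) (Fin N) ℂ) := by
  rw [pencil_extTuple]
  simp [tailPoint, ite_smul]

theorem forall_eq_of_permuteTail_image (hlam : Function.Injective lam)
    (hQ : ∀ j, (Q j).IsHermitian)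
    (h : ∀ τ : Equiv.Perm (Fin n),
      permuteCoords (permuteTail τ) '' jointSpectrum (extTuple lam Q) =
        jointSpectrum (extTuple lam Q)) : ∀ i j, Q i = Q j := by
  have himp : ∀ (i j : Fin n) (u y z : ℂ),
      IsUnit (Matrix.diagonal lam + u • shift N + y • Q j -
        z • (1 : Matrix (Fin N) (Fin N) ℂ)) →
      IsUnit (Matrix.diagonal lam + u • shift N + y • Q i -
        z • (1 : Matrix (Fin N) (Fin N) ℂ)) := by
    intro i j u y z hj
    by_contra hi
    rw [← pencil_tailPoint, ← mk_mem_jointSpectrum _ (tailPoint_ne_zero i u y z)] at hi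
    have h1 := mk_mem_image_permuteCoords (permuteTail (Equiv.swap i j)) _
      (tailPoint_ne_zero i u y z)
      (by rw [tailPoint_comp_swap]; exact tailPoint_ne_zero j u y z) hi
    simp only [tailPoint_comp_swap] at h1
    rw [h, mk_mem_jointSpectrum, pencil_tailPoint] at h1
    exact h1 hj
  intro i j
  have hch : ∀ᶠ p : ℂ × ℂ in nhds 0,
      (Matrix.diagonal lam + p.1 • shift N + p.2 • Q i).charpoly =
      (Matrix.diagonal lam + p.1 • shift N + p.2 • Q j).charpoly := by
    filter_upwards [eventually_nodup_roots hlam (shift N) (Q i)] with p hp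
    exact charpoly_eq_of_spectrum_eq (fun z => ⟨himp j i _ _ z, himp i j _ _ z⟩) hp
  have hdet : ∀ᶠ u : ℂ in nhds 0, ∀ᶠ y : ℂ in nhds 0, ∀ z : ℂ,
      (Matrix.diagonal (fun l => lam l - z) + u • shift N + y • Q i).det =
      (Matrix.diagonal (fun l => lam l - z) + u • shift N + y • Q j).det := by
    have h0 : (0 : ℂ × ℂ) = (0, 0) := rfl
    rw [h0, nhds_prod_eq] at hch
    -- Currying fixes a small `u` first and leaves a neighbourhood of `y = 0`, where one can
    -- differentiate in `y`.
    filter_upwards [hch.curry] with u hu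
    filter_upwards [hu] with y hy z
    have hz : ∀ B : Matrix (Fin N) (Fin N) ℂ,
        (Matrix.diagonal (fun l => lam l - z) + u • shift N + y • B).det =
        (-1) ^ N * (Matrix.diagonal lam + u • shift N + y • B).charpoly.eval z := by
      intro B
      have h1 : Matrix.diagonal (fun l => lam l - z) + u • shift N + y • B =
          -(Matrix.scalar (Fin N) z - (Matrix.diagonal lam + u • shift N + y • B)) := by
        have h2 : Matrix.diagonal (fun l => lam l - z) =
            Matrix.diagonal lam - Matrix.scalar (Fin N) z := by
          rw [Matrix.scalar_apply, Matrix.diagonal_sub]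
        rw [h2]
        abel
      rw [h1, Matrix.det_neg, Fintype.card_fin, Matrix.eval_charpoly]
    rw [hz, hz, hy]
  have htr : ∀ᶠ u : ℂ in nhds 0, ∀ z, z ∉ Set.range lam →
      ((Matrix.diagonal (fun l => lam l - z) + u • shift N)⁻¹ * (Q i - Q j)).trace = 0 := by
    filter_upwards [hdet] with u hu z hz
    rw [mul_sub, Matrix.trace_sub, sub_eq_zero]
    refine trace_eq_of_det_eq ?_ (hu.mono fun y hy => hy z)
    rw [det_diagonal_add_shift, isUnit_iff_ne_zero, Finset.prod_ne_zero_iff]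
    exact fun l _ h0 => hz ⟨l, sub_eq_zero.1 h0⟩
  have hup := eq_zero_of_trace_resolvent hlam htr
  have hD : (Q i - Q j).IsHermitian := (hQ i).sub (hQ j)
  rw [← sub_eq_zero]
  ext b c
  rcases le_total b c with hbc | hbc
  · exact hup b c hbc
  · rw [← hD.apply, hup c b hbc, star_zero, Matrix.zero_apply]

end Permutation

/-! ### Common invariant subspaces. -/

section

variable {n N k : ℕ}

section CommonRange
variable {M : Submodule ℂ (Fin N → ℂ)}

theorem finrank_range_idempotent {E : Matrix (Fin N) (Fin N) ℂ} (hE : E * E = E) {d : ℕ}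
    (ht : E.trace = d) : Module.finrank ℂ (LinearMap.range (Matrix.toLin' E)) = d := by
  have h1 : IsIdempotentElem (Matrix.toLin' E) := by
    rw [IsIdempotentElem, Module.End.mul_eq_comp, ← Matrix.toLin'_mul, hE]
  have h2 := (LinearMap.IsIdempotentElem.isProj_range _ h1).trace
  rw [Matrix.trace_toLin'_eq, ht] at h2
  exact_mod_cast h2.symm

/-- Hermitian idempotents which fix all vectors of a subspace whose dimension is their common
trace coincide. -/
theorem forall_eq_of_mulVec_eq {Q : Fin n → Matrix (Fin N) (Fin N) ℂ}
    (hH : ∀ j, (Q j).IsHermitian) (hQ : ∀ j, Q j * Q j = Q j) {d : ℕ}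
    (ht : ∀ j, (Q j).trace = d) (hd : Module.finrank ℂ M = d)
    (h : ∀ j, ∀ v ∈ M, Q j *ᵥ v = v) : ∀ i j, Q i = Q j := by
  have hrange : ∀ j, M = LinearMap.range (Matrix.toLin' (Q j)) := by
    intro j
    refine Submodule.eq_of_le_of_finrank_eq ?_ ?_
    · intro v hv
      exact ⟨v, by rw [Matrix.toLin'_apply, h j v hv]⟩
    · rw [hd, finrank_range_idempotent (hQ j) (ht j)]
  have hmul : ∀ i j, Q i * Q j = Q j := by
    intro i j
    refine Matrix.toLin'.injective (LinearMap.ext fun v => ?_)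
    rw [Matrix.toLin'_mul, LinearMap.comp_apply]
    have h1 : Matrix.toLin' (Q j) v ∈ M := by
      rw [hrange j]; exact LinearMap.mem_range_self _ v
    rw [Matrix.toLin'_apply (Q i), h i _ h1]
  intro i j
  -- The adjoint of `Q_i Q_j = Q_j` is `Q_j Q_i = Q_j`, whereas `hmul j i` evaluates the same
  -- product to `Q_i`.
  have h1 := congrArg Matrix.conjTranspose (hmul i j)
  rw [Matrix.conjTranspose_mul, (hH i).eq, (hH j).eq, hmul j i] at h1
  exact h1

end CommonRange

theorem coe_aeval_restrict {B : Matrix (Fin N) (Fin N) ℂ} {M : Submodule ℂ (Fin N → ℂ)}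
    (hM : ∀ v ∈ M, Matrix.toLin' B v ∈ M) (p : ℂ[X]) (v : M) :
    ((aeval ((Matrix.toLin' B).restrict hM) p v : M) : Fin N → ℂ) = aeval B p *ᵥ (v : Fin N → ℂ) := by
  induction p using Polynomial.induction_on' generalizing v with
  | add p q hp hq => simp [hp, hq, Matrix.add_mulVec]
  | monomial d a =>
    rw [aeval_monomial, aeval_monomial, Algebra.algebraMap_eq_smul_one,
      Algebra.algebraMap_eq_smul_one, smul_mul_assoc, smul_mul_assoc, one_mul, one_mul,
      Matrix.smul_mulVec, LinearMap.smul_apply, Submodule.coe_smul]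
    congr 1
    induction d generalizing v with
    | zero => simp
    | succ d ih =>
      rw [pow_succ, pow_succ, Module.End.mul_apply, ih, ← Matrix.mulVec_mulVec]
      rfl

theorem aeval_mulVec_of_eigenvector {B : Matrix (Fin N) (Fin N) ℂ} {z : ℂ} {v : Fin N → ℂ}
    (h : B *ᵥ v = z • v) (p : ℂ[X]) : aeval B p *ᵥ v = p.eval z • v := by
  obtain ⟨r, hr⟩ := X_sub_C_dvd_sub_C_eval (a := z) (p := p)
  have h1 : p = r * (X - C z) + C (p.eval z) := by rw [mul_comm, ← hr]; ring
  have h2 : aeval B (X - C z) *ᵥ v = 0 := by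
    rw [map_sub, aeval_X, aeval_C, Algebra.algebraMap_eq_smul_one, Matrix.sub_mulVec, h,
      Matrix.smul_mulVec, Matrix.one_mulVec, sub_self]
  conv_lhs => rw [h1]
  rw [map_add, map_mul, Matrix.add_mulVec, ← Matrix.mulVec_mulVec, h2, Matrix.mulVec_zero, zero_add,
    aeval_C, Algebra.algebraMap_eq_smul_one, Matrix.smul_mulVec, Matrix.one_mulVec]

/-- Block triangularity without a choice of basis: `Y` itself is the product of the two matrices, in
this order. -/
theorem det_eq_mul_of_invariant {Y E : Matrix (Fin N) (Fin N) ℂ}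
    (hE : E * E = E) (hY : E * (Y * E) = Y * E) :
    Y.det = (E + Y * (1 - E)).det * (Y * E + (1 - E)).det := by
  rw [← Matrix.det_mul]
  congr 1
  have h1 : Y * E * (Y * E) = Y * (E * (Y * E)) := mul_assoc _ _ _
  have h2 : Y * E * E = Y * E := by rw [mul_assoc, hE]
  simp only [mul_add, add_mul, mul_sub, sub_mul, mul_one, hE, hY, h1, h2]
  abel

/-! ### Factoring the determinant along an invariant subspace. -/

section Divisors

/-- The determinant of the restriction of the pencil to the range of the projection `E`. -/
def detRestrict (A : Fin n → Matrix (Fin N) (Fin N) ℂ) (E : Matrix (Fin N) (Fin N) ℂ) :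
    MvPolynomial (Option (Fin n)) ℂ :=
  ((∑ j, (MvPolynomial.X (some j) : MvPolynomial (Option (Fin n)) ℂ) •
      (A j).map (MvPolynomial.C : ℂ →+* MvPolynomial (Option (Fin n)) ℂ)
    - (MvPolynomial.X none : MvPolynomial (Option (Fin n)) ℂ) • 1) *
      E.map (MvPolynomial.C : ℂ →+* MvPolynomial (Option (Fin n)) ℂ) +
    (1 - E).map (MvPolynomial.C : ℂ →+* MvPolynomial (Option (Fin n)) ℂ)).det

/-- The determinant of the pencil that is induced on the quotient by the range of the
projection `E`. -/
def detQuotient (A : Fin n → Matrix (Fin N) (Fin N) ℂ) (E : Matrix (Fin N) (Fin N) ℂ) :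
    MvPolynomial (Option (Fin n)) ℂ :=
  (E.map (MvPolynomial.C : ℂ →+* MvPolynomial (Option (Fin n)) ℂ) +
    (∑ j, (MvPolynomial.X (some j) : MvPolynomial (Option (Fin n)) ℂ) •
      (A j).map (MvPolynomial.C : ℂ →+* MvPolynomial (Option (Fin n)) ℂ)
    - (MvPolynomial.X none : MvPolynomial (Option (Fin n)) ℂ) • 1) *
    (1 - E).map (MvPolynomial.C : ℂ →+* MvPolynomial (Option (Fin n)) ℂ)).det

variable {A : Fin n → Matrix (Fin N) (Fin N) ℂ} {E : Matrix (Fin N) (Fin N) ℂ}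

theorem map_eval_pencil (x : Option (Fin n) → ℂ) :
    (∑ j, (MvPolynomial.X (some j) : MvPolynomial (Option (Fin n)) ℂ) •
      (A j).map (MvPolynomial.C : ℂ →+* MvPolynomial (Option (Fin n)) ℂ)
    - (MvPolynomial.X none : MvPolynomial (Option (Fin n)) ℂ) • 1).map (MvPolynomial.eval x) =
    pencil A x := by
  ext a b
  by_cases h : a = b <;> simp [pencil, Matrix.sum_apply, h]

theorem map_eval_map_C (x : Option (Fin n) → ℂ) (B : Matrix (Fin N) (Fin N) ℂ) :
    (B.map (MvPolynomial.C : ℂ →+* MvPolynomial (Option (Fin n)) ℂ)).map (MvPolynomial.eval x) =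
      B := by
  ext a b
  simp

theorem eval_detRestrict (x : Option (Fin n) → ℂ) :
    MvPolynomial.eval x (detRestrict A E) = (pencil A x * E + (1 - E)).det := by
  rw [detRestrict, RingHom.map_det, map_add, map_mul]
  simp only [RingHom.mapMatrix_apply, map_eval_pencil, map_eval_map_C]

theorem eval_detQuotient (x : Option (Fin n) → ℂ) :
    MvPolynomial.eval x (detQuotient A E) = (E + pencil A x * (1 - E)).det := by
  rw [detQuotient, RingHom.map_det, map_add, map_mul]
  simp only [RingHom.mapMatrix_apply, map_eval_pencil, map_eval_map_C]

theorem mul_pencil_mul (hE : E * E = E) (hA : ∀ j, E * (A j * E) = A j * E)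
    (x : Option (Fin n) → ℂ) : E * (pencil A x * E) = pencil A x * E := by
  rw [pencil, sub_mul, mul_sub, Finset.sum_mul, Finset.mul_sum, smul_mul_assoc, one_mul,
    mul_smul_comm, hE]
  congr 1
  exact Finset.sum_congr rfl fun j _ => by rw [smul_mul_assoc, mul_smul_comm, hA]

theorem detPencil_eq_mul (hE : E * E = E) (hA : ∀ j, E * (A j * E) = A j * E) :
    detPencil A = detQuotient A E * detRestrict A E := by
  refine MvPolynomial.funext fun x => ?_
  rw [map_mul, eval_detPencil, eval_detQuotient, eval_detRestrict]
  exact det_eq_mul_of_invariant hE (mul_pencil_mul hE hA x)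

theorem mem_range_iff (hE : E * E = E) {v : Fin N → ℂ} :
    v ∈ LinearMap.range (Matrix.toLin' E) ↔ E *ᵥ v = v := by
  constructor
  · rintro ⟨w, rfl⟩
    rw [Matrix.toLin'_apply, Matrix.mulVec_mulVec, hE]
  · exact fun h => ⟨v, h⟩

theorem det_restrict_eq_zero_iff (hE : E * E = E) {Y : Matrix (Fin N) (Fin N) ℂ}
    (hY : E * (Y * E) = Y * E) :
    (Y * E + (1 - E)).det = 0 ↔ ∃ v ≠ 0, E *ᵥ v = v ∧ Y *ᵥ v = 0 := by
  rw [← Matrix.exists_mulVec_eq_zero_iff]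
  refine exists_congr fun v => and_congr_right fun _ => ⟨fun h => ?_, fun ⟨h1, h2⟩ => ?_⟩
  · have h1 : (1 - E) * (Y * E + (1 - E)) = 1 - E := by
      simp only [mul_add, mul_sub, sub_mul, mul_one, one_mul, hE, hY]
      abel
    have h2 := congrArg ((1 - E) *ᵥ ·) h
    simp only [Matrix.mulVec_mulVec, h1, Matrix.mulVec_zero] at h2
    have h3 : E *ᵥ v = v := by
      rw [Matrix.sub_mulVec, Matrix.one_mulVec, sub_eq_zero] at h2
      exact h2.symm
    refine ⟨h3, ?_⟩
    rwa [Matrix.add_mulVec, ← Matrix.mulVec_mulVec, h2, h3, add_zero] at h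
  · rw [Matrix.add_mulVec, ← Matrix.mulVec_mulVec, Matrix.sub_mulVec, Matrix.one_mulVec, h1, h2,
      sub_self, add_zero]

theorem isUnit_pencil_restrict_iff (hE : E * E = E) (hA : ∀ j, E * (A j * E) = A j * E)
    (hM : ∀ j, ∀ v ∈ LinearMap.range (Matrix.toLin' E),
      Matrix.toLin' (A j) v ∈ LinearMap.range (Matrix.toLin' E)) (x : Option (Fin n) → ℂ) :
    IsUnit (pencil (fun j => (Matrix.toLin' (A j)).restrict (hM j)) x) ↔
      MvPolynomial.eval x (detRestrict A E) ≠ 0 := by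
  have hcoe : ∀ v : LinearMap.range (Matrix.toLin' E),
      ((pencil (fun j => (Matrix.toLin' (A j)).restrict (hM j)) x v :
        LinearMap.range (Matrix.toLin' E)) : Fin N → ℂ) = pencil A x *ᵥ (v : Fin N → ℂ) := by
    intro v
    simp [pencil, Matrix.sub_mulVec, Matrix.sum_mulVec, Matrix.smul_mulVec, LinearMap.sum_apply]
  rw [← not_iff_not, not_not, eval_detRestrict,
    det_restrict_eq_zero_iff hE (mul_pencil_mul hE hA x), LinearMap.isUnit_iff_ker_eq_bot,
    Submodule.eq_bot_iff]
  push Not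
  constructor
  · rintro ⟨v, hv, hv0⟩
    refine ⟨v, fun h => hv0 (Subtype.ext h), (mem_range_iff hE).1 v.2, ?_⟩
    rw [← hcoe, LinearMap.mem_ker.1 hv, Submodule.coe_zero]
  · rintro ⟨v, hv0, hv, hv'⟩
    refine ⟨⟨v, (mem_range_iff hE).2 hv⟩, ?_, fun h => hv0 (congrArg Subtype.val h)⟩
    rw [LinearMap.mem_ker]
    exact Subtype.ext ((hcoe _).trans hv')

end Divisors

variable {A : Fin n → Matrix (Fin N) (Fin N) ℂ}
  {R : Fin k → MvPolynomial (Option (Fin n)) ℂ} {m : Fin k → ℕ}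

theorem mem_lineRoots (hfac : IsFactorization A R m) {j : Fin n} {s : Fin k} {z : ℂ} :
    z ∈ lineRoots R j s ↔ MvPolynomial.eval (linePoint j 1 z) (R s) = 0 := by
  rw [lineRoots_eq, Multiset.mem_toFinset, mem_roots (hfac.lineHom_ne_zero j s), IsRoot.def,
    eval_lineHom]

theorem exists_mem_lineRoots (hfac : IsFactorization A R m) (j : Fin n) (s : Fin k) :
    ∃ z, z ∈ lineRoots R j s := by
  have h1 : (lineHom j (R s)).degree ≠ 0 := by
    intro h
    have h2 := hfac.natDegree_lineHom j s
    rw [natDegree_eq_of_degree_eq_some h] at h2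
    have h3 := MvPolynomial.totalDegree_eq_zero_iff_eq_C.1 h2.symm
    refine (hfac.irreducible s).not_isUnit ?_
    rw [h3]
    refine (isUnit_iff_ne_zero.2 fun h0 => (hfac.irreducible s).ne_zero ?_).map MvPolynomial.C
    rw [h3, h0, MvPolynomial.C_0]
  obtain ⟨z, hz⟩ := IsAlgClosed.exists_root _ h1
  refine ⟨z, (mem_lineRoots hfac).2 ?_⟩
  rw [← eval_lineHom]
  exact hz

theorem linePoint_ne_zero (j : Fin n) (z : ℂ) : linePoint j 1 z ≠ 0 := fun h => by
  have := congrFun h (some j)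
  simp [linePoint] at this

variable {S : Finset (Fin k)}

/-- A root of the complementary factor that was an eigenvalue of `A j` on `M` would give a point of
the restricted joint spectrum on some `R s'` with `s' ∈ S`, against disjointness of the roots. -/
theorem capQ_eq_of_correspondsToInvariantSubspace (hfac : IsFactorization A R m)
    (hadm : Admissible A R) (h : CorrespondsToInvariantSubspace A R m S) :
    ∀ i j, capQ A R m S i = capQ A R m S j := by
  obtain ⟨M, hM, hdim, hspec⟩ := h
  refine forall_eq_of_mulVec_eq (M := M) (capQ_isHermitian · S) (capQ_mul_self · S)
    (trace_capQ hfac hadm · S) hdim fun j v hv => ?_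
  set f := (Matrix.toLin' (A j)).restrict (hM j) with hf
  have hg : IsUnit (aeval f (qPoly R m Sᶜ j)) := by
    refine Finset.prod_induction _ (fun p => IsUnit (aeval f p))
      (fun p q hp hq => by rw [map_mul]; exact hp.mul hq) (by rw [map_one]; exact isUnit_one)
      fun s hs => Finset.prod_induction _ (fun p => IsUnit (aeval f p))
      (fun p q hp hq => by rw [map_mul]; exact hp.mul hq) (by rw [map_one]; exact isUnit_one)
      fun l hl => ?_
    rw [map_pow]
    refine IsUnit.pow _ ?_
    by_contra hu
    have h1 : Projectivization.mk ℂ _ (linePoint_ne_zero j l) ∈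
        jointSpectrum (fun j => (Matrix.toLin' (A j)).restrict (hM j)) := by
      rw [mk_mem_jointSpectrum, pencil_linePoint, one_smul]
      rwa [map_sub, aeval_X, aeval_C, Algebra.algebraMap_eq_smul_one] at hu
    rw [hspec, Set.mem_iUnion₂] at h1
    obtain ⟨s', hs', h1⟩ := h1
    rw [mk_mem_zeroLocus (hfac.isHomogeneous s'), ← mem_lineRoots hfac] at h1
    refine Finset.disjoint_left.1 (hfac.lineRoots_disjoint hadm j (s := s) (s' := s') ?_) hl h1
    rintro rfl
    exact Finset.mem_compl.1 hs hs'
  have hzero : aeval f (qPoly R m S j) * aeval f (qPoly R m Sᶜ j) = 0 := by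
    rw [← map_mul, ← hfac.charpoly_eq hadm]
    refine LinearMap.ext fun w => Subtype.ext ?_
    rw [coe_aeval_restrict, Matrix.aeval_self_charpoly, Matrix.zero_mulVec]
    rfl
  have hq : aeval f (qPoly R m S j) = 0 := (hg.mul_left_eq_zero).1 hzero
  have hqv : aeval (A j) (qPoly R m S j) *ᵥ v = 0 := by
    have := coe_aeval_restrict (hM j) (qPoly R m S j) ⟨v, hv⟩
    rw [← hf, hq] at this
    exact this.symm
  have hPv : projP A R m S j *ᵥ v = v := by
    ext a
    -- The vector `v` is encoded as the matrix all of whose columns are `v`.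
    have h1 := hfac.projP_mul_eq hadm j S (B := Matrix.of fun b _ => v b) (by
      ext b c
      exact congrFun hqv b)
    exact congrFun (congrFun h1 a) a
  rw [capQ_eq, ← hPv, Matrix.mulVec_mulVec, capProj_mul]

/-! ### The irreducible factors carried by the range of the projection. -/

section Range
variable (hfac : IsFactorization A R m) (hadm : Admissible A R) (j : Fin n)
include hfac hadm

theorem capQ_mul_aeval_mul_capQ (r : ℂ[X]) :
    capQ A R m S j * (aeval (A j) r * capQ A R m S j) = aeval (A j) r * capQ A R m S j := by
  have h1 : aeval (A j) r * capQ A R m S j =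
      projP A R m S j * (aeval (A j) r * capQ A R m S j) := by
    rw [capQ_eq, ← mul_assoc, ← hfac.aeval_mul_projP hadm, mul_assoc,
      mul_capProj (hfac.projP_mul_self hadm j S)]
  rw [h1, ← mul_assoc, capQ_eq, capProj_mul]

theorem capQ_mul_mul_capQ :
    capQ A R m S j * (A j * capQ A R m S j) = A j * capQ A R m S j := by
  simpa using capQ_mul_aeval_mul_capQ (S := S) hfac hadm j X

/-- A zero gives an eigenvector of `A j` in the range of `capQ`, where `qPoly R m S j` annihilates
`A j`. -/
theorem eval_qPoly_of_detRestrict {z : ℂ}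
    (h : MvPolynomial.eval (linePoint j 1 z) (detRestrict A (capQ A R m S j)) = 0) :
    (qPoly R m S j).eval z = 0 := by
  have hE := capQ_mul_self (A := A) (R := R) (m := m) j S
  rw [eval_detRestrict, pencil_linePoint, one_smul, det_restrict_eq_zero_iff hE] at h
  · obtain ⟨v, hv0, hv, hv'⟩ := h
    have h1 : A j *ᵥ v = z • v := by
      rwa [Matrix.sub_mulVec, Matrix.smul_mulVec, Matrix.one_mulVec, sub_eq_zero] at hv'
    have h2 := aeval_mulVec_of_eigenvector h1 (qPoly R m S j)
    have h3 : aeval (A j) (qPoly R m S j) * capQ A R m S j = 0 := by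
      rw [capQ_eq, ← mul_capProj (hfac.projP_mul_self hadm j S), ← mul_assoc,
        hfac.aeval_qPoly_mul_projP hadm, zero_mul]
    rw [← hv, Matrix.mulVec_mulVec, h3, Matrix.zero_mulVec, hv] at h2
    exact (smul_eq_zero.1 h2.symm).resolve_right hv0
  · rw [sub_mul, mul_sub, capQ_mul_mul_capQ hfac hadm, smul_mul_assoc, one_mul, mul_smul_comm, hE]

/-- Dually, the complementary factor annihilates the operator that `A j` induces on the quotient.
Here `w` represents an eigenvector of that operator, and `1 - E` plays the role of the quotient map.
-/
theorem eval_qPoly_of_detQuotient {z : ℂ}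
    (h : MvPolynomial.eval (linePoint j 1 z) (detQuotient A (capQ A R m S j)) = 0) :
    (qPoly R m Sᶜ j).eval z = 0 := by
  set E := capQ A R m S j with hEdef
  set g := qPoly R m Sᶜ j with hg
  have hE : E * E = E := capQ_mul_self j S
  rw [eval_detQuotient, pencil_linePoint, one_smul, ← Matrix.exists_mulVec_eq_zero_iff] at h
  obtain ⟨v, hv0, hv⟩ := h
  set w := (1 - E) *ᵥ v with hw
  rw [Matrix.add_mulVec, ← Matrix.mulVec_mulVec, ← hw] at hv
  have hw0 : w ≠ 0 := by
    intro h0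
    rw [h0, Matrix.mulVec_zero, add_zero] at hv
    rw [hw, Matrix.sub_mulVec, Matrix.one_mulVec, hv, sub_zero] at h0
    exact hv0 h0
  have hEw : (1 - E) *ᵥ w = w := by
    rw [hw, Matrix.mulVec_mulVec]
    congr 1
    simp [mul_sub, sub_mul, hE]
  have h1 : (1 - E) * aeval (A j) g = 0 := by
    have h2 : projP A R m S j * aeval (A j) g = aeval (A j) g := by
      refine hfac.projP_mul_eq hadm j S ?_
      rw [← map_mul, ← hfac.charpoly_eq hadm, Matrix.aeval_self_charpoly]
    rw [← h2, ← mul_assoc, sub_mul, one_mul, hEdef, capQ_eq, capProj_mul, sub_self, zero_mul]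
  obtain ⟨r, hr⟩ := X_sub_C_dvd_sub_C_eval (a := z) (p := g)
  have h2 : g = r * (X - C z) + C (g.eval z) := by rw [mul_comm, ← hr]; ring
  have h3 : aeval (A j) (X - C z) *ᵥ w = -(E *ᵥ v) := by
    rw [map_sub, aeval_X, aeval_C, Algebra.algebraMap_eq_smul_one]
    exact eq_neg_of_add_eq_zero_right hv
  have h4 : (1 - E) * (aeval (A j) r * E) = 0 := by
    rw [sub_mul, one_mul, hEdef, capQ_mul_aeval_mul_capQ hfac hadm, sub_self]
  have h5 : ((1 - E) * aeval (A j) g) *ᵥ w = g.eval z • w := by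
    conv_lhs => rw [h2]
    rw [map_add, map_mul, mul_add, Matrix.add_mulVec, ← mul_assoc, ← Matrix.mulVec_mulVec w, h3,
      Matrix.mulVec_neg, Matrix.mulVec_mulVec, mul_assoc, h4, Matrix.zero_mulVec, neg_zero, zero_add,
      aeval_C, Algebra.algebraMap_eq_smul_one, mul_smul_comm, mul_one, Matrix.smul_mulVec, hEw]
  rw [h1, Matrix.zero_mulVec] at h5
  exact (smul_eq_zero.1 h5.symm).resolve_right hw0

theorem dvd_detRestrict_iff (hA : ∀ i, capQ A R m S j * (A i * capQ A R m S j) =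
      A i * capQ A R m S j) (s : Fin k) :
    R s ∣ detRestrict A (capQ A R m S j) ↔ s ∈ S := by
  obtain ⟨z, hz⟩ := exists_mem_lineRoots hfac j s
  have heval : ∀ F, R s ∣ F → MvPolynomial.eval (linePoint j 1 z) F = 0 := by
    rintro _ ⟨g, rfl⟩
    rw [map_mul, (mem_lineRoots hfac).1 hz, zero_mul]
  constructor
  · intro h
    by_contra hs
    exact hfac.eval_qPoly_ne_zero hadm hs hz (eval_qPoly_of_detRestrict hfac hadm j (heval _ h))
  · intro hs
    have h1 := hfac.dvd_detPencil s
    rw [detPencil_eq_mul (capQ_mul_self j S) hA] at h1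
    refine ((hfac.irreducible s).prime.dvd_or_dvd h1).resolve_left fun h2 => ?_
    exact hfac.eval_qPoly_ne_zero hadm (S := Sᶜ) (by simpa using hs) hz
      (eval_qPoly_of_detQuotient hfac hadm j (heval _ h2))

theorem eval_detRestrict_eq_zero_iff (hA : ∀ i, capQ A R m S j * (A i * capQ A R m S j) =
      A i * capQ A R m S j) (x : Option (Fin n) → ℂ) :
    MvPolynomial.eval x (detRestrict A (capQ A R m S j)) = 0 ↔
      ∃ s ∈ S, MvPolynomial.eval x (R s) = 0 := by
  have hdvd := dvd_detRestrict_iff hfac hadm j hA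
  constructor
  · intro h
    have hmul := detPencil_eq_mul (capQ_mul_self j S) hA
    have h0 : detRestrict A (capQ A R m S j) ≠ 0 :=
      right_ne_zero_of_mul (hmul ▸ detPencil_ne_zero A)
    -- Every prime factor of `detRestrict` divides the determinant of the pencil, so it is
    -- associated to some `R s`; only the set of factors matters, not their multiplicities.
    obtain ⟨f, hf, hass⟩ := UniqueFactorizationMonoid.exists_prime_factors _ h0
    obtain ⟨g, hg⟩ := hass.symm.dvd
    obtain ⟨u, hu⟩ := hass
    have h1 : MvPolynomial.eval x f.prod = 0 := by
      rw [hg, map_mul, h, zero_mul]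
    rw [map_multiset_prod, Multiset.prod_eq_zero_iff, Multiset.mem_map] at h1
    obtain ⟨p, hp, hpx⟩ := h1
    have hpd : p ∣ detRestrict A (capQ A R m S j) :=
      (Multiset.dvd_prod hp).trans ⟨u, hu.symm⟩
    have h2 : p ∣ ∏ s, R s ^ m s := by
      rw [← hfac.det_eq, hmul]
      exact hpd.mul_left _
    obtain ⟨s, -, h3⟩ := (hf p hp).exists_mem_finset_dvd h2
    have h4 : Associated p (R s) :=
      (hf p hp).irreducible.associated_of_dvd (hfac.irreducible s) ((hf p hp).dvd_of_dvd_pow h3)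
    refine ⟨s, (hdvd s).1 (h4.symm.dvd.trans hpd), ?_⟩
    obtain ⟨c, hc⟩ := h4.dvd
    rw [hc, map_mul, hpx, zero_mul]
  · rintro ⟨s, hs, h⟩
    obtain ⟨c, hc⟩ := (hdvd s).2 hs
    rw [hc, map_mul, h, zero_mul]

end Range

theorem pencil_of_isEmpty {κ : Type*} [Fintype κ] [IsEmpty κ] {𝒜 : Type*} [Ring 𝒜] [Algebra ℂ 𝒜]
    (B : κ → 𝒜) (x : Option κ → ℂ) : pencil B x = algebraMap ℂ 𝒜 (-x none) := by
  rw [pencil, Finset.univ_eq_empty, Finset.sum_empty, zero_sub, map_neg,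
    Algebra.algebraMap_eq_smul_one]

/-- For the empty tuple the pencil is a nonzero scalar at every projective point, so both spectra
are empty and any subspace of the right dimension serves. -/
theorem correspondsToInvariantSubspace_of_isEmpty [IsEmpty (Fin n)]
    (hfac : IsFactorization A R m) : CorrespondsToInvariantSubspace A R m S := by
  have hd : dimS R m S ≤ Module.finrank ℂ (Fin N → ℂ) := by
    rw [Module.finrank_fin_fun]; exact hfac.dimS_le S
  obtain ⟨f, hf⟩ := exists_linearIndependent_of_le_finrank hd
  have hrep : ∀ p : Projectivization ℂ (Option (Fin n) → ℂ), p.rep none ≠ 0 := by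
    intro p h0
    refine p.rep_nonzero (funext fun o => ?_)
    rcases o with _ | i
    · exact h0
    · exact isEmptyElim i
  refine ⟨Submodule.span ℂ (Set.range f), fun j => isEmptyElim j, ?_, ?_⟩
  · rw [finrank_span_eq_card hf, Fintype.card_fin]
  · ext p
    refine iff_of_false ?_ ?_
    · rw [jointSpectrum, Set.mem_ofPred_eq, not_not]
      rw [pencil_of_isEmpty]
      exact (isUnit_iff_ne_zero.2 (neg_ne_zero.2 (hrep p))).map (algebraMap ℂ _)
    · rw [Set.mem_iUnion₂]
      rintro ⟨s, -, hs⟩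
      obtain ⟨g, hg⟩ := hfac.dvd_detPencil s
      have h1 : MvPolynomial.eval p.rep (detPencil A) = 0 := by
        rw [hg, map_mul, show MvPolynomial.eval p.rep (R s) = 0 from hs, zero_mul]
      rw [eval_detPencil, pencil_of_isEmpty] at h1
      have h2 := (isUnit_iff_ne_zero.2 (neg_ne_zero.2 (hrep p))).map
        (algebraMap ℂ (Matrix (Fin N) (Fin N) ℂ))
      rw [Matrix.isUnit_iff_isUnit_det, h1] at h2
      exact not_isUnit_zero h2

theorem correspondsToInvariantSubspace_of_capQ_eq (hfac : IsFactorization A R m)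
    (hadm : Admissible A R) (h : ∀ i j, capQ A R m S i = capQ A R m S j) :
    CorrespondsToInvariantSubspace A R m S := by
  rcases isEmpty_or_nonempty (Fin n) with hn | ⟨⟨j⟩⟩
  · exact correspondsToInvariantSubspace_of_isEmpty hfac
  have hE : capQ A R m S j * capQ A R m S j = capQ A R m S j := capQ_mul_self j S
  have hA : ∀ i, capQ A R m S j * (A i * capQ A R m S j) = A i * capQ A R m S j := by
    intro i
    -- Invariance under `A i` is known for the range of the `i`-th projection, which is now the same
    -- matrix as the `j`-th.
    rw [h j i]
    exact capQ_mul_mul_capQ hfac hadm i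
  have hM : ∀ i, ∀ v ∈ LinearMap.range (Matrix.toLin' (capQ A R m S j)),
      Matrix.toLin' (A i) v ∈ LinearMap.range (Matrix.toLin' (capQ A R m S j)) := by
    intro i v hv
    rw [mem_range_iff hE] at hv ⊢
    rw [Matrix.toLin'_apply, ← hv, Matrix.mulVec_mulVec, Matrix.mulVec_mulVec, mul_assoc, hA,
      ← Matrix.mulVec_mulVec, hv]
  refine ⟨_, hM, finrank_range_idempotent hE (trace_capQ hfac hadm j S), ?_⟩
  ext p
  rw [jointSpectrum, Set.mem_ofPred_eq, isUnit_pencil_restrict_iff hE hA hM, not_not,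
    eval_detRestrict_eq_zero_iff hfac hadm j hA, Set.mem_iUnion₂]
  simp only [zeroLocus, Set.mem_ofPred_eq, exists_prop]

end

end JointSpec

end

theorem mainTheorem1 {n N k : ℕ} (A : Fin n → Matrix (Fin N) (Fin N) ℂ)
    (R : Fin k → MvPolynomial (Option (Fin n)) ℂ) (m : Fin k → ℕ)
    (hfac : JointSpec.IsFactorization A R m) (hadm : JointSpec.Admissible A R)
    (S : Finset (Fin k)) (lam : Fin N → ℂ) (hlam : Function.Injective lam) :
    List.TFAE [
      -- (a)
      JointSpec.CorrespondsToInvariantSubspace A R m S,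
      -- (b), as an equality of subsets of projective space
      JointSpec.jointSpectrum (JointSpec.capQ A R m S) =
        JointSpec.zeroLocus
          (JointSpec.planePoly n (JointSpec.dimS R m S) (N - JointSpec.dimS R m S)),
      -- (b), counted with multiplicities
      JointSpec.detPencil (JointSpec.capQ A R m S) =
        (-1) ^ (N - JointSpec.dimS R m S) *
          JointSpec.planePoly n (JointSpec.dimS R m S) (N - JointSpec.dimS R m S),
      -- (c)
      ∀ τ : Equiv.Perm (Fin n),
        JointSpec.permuteCoords (JointSpec.permuteTail τ) ''
            JointSpec.jointSpectrum (JointSpec.extTuple lam (JointSpec.capQ A R m S)) =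
          JointSpec.jointSpectrum (JointSpec.extTuple lam (JointSpec.capQ A R m S))] := by
  have hH : ∀ j, (JointSpec.capQ A R m S j).IsHermitian :=
    (JointSpec.capQ_isHermitian · S)
  have hQ : ∀ j, JointSpec.capQ A R m S j * JointSpec.capQ A R m S j =
      JointSpec.capQ A R m S j := (JointSpec.capQ_mul_self · S)
  have ht : ∀ j, (JointSpec.capQ A R m S j).trace = JointSpec.dimS R m S :=
    (JointSpec.trace_capQ hfac hadm · S)
  tfae_have 1 → 3 := fun h => JointSpec.detPencil_of_forall_eq hQ ht (hfac.dimS_le S)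
    (JointSpec.capQ_eq_of_correspondsToInvariantSubspace hfac hadm h)
  tfae_have 3 → 2 := JointSpec.jointSpectrum_of_detPencil
  tfae_have 2 → 4 := fun h => JointSpec.permuteTail_image_of_forall_eq
    (JointSpec.forall_eq_of_jointSpectrum hH hQ ht h)
  tfae_have 4 → 1 := fun h => JointSpec.correspondsToInvariantSubspace_of_capQ_eq hfac hadm
    (JointSpec.forall_eq_of_permuteTail_image hlam hH h)
  tfae_finish
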